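/- Let $m\ge 3$ and $n\ge 0$ be integers, let $\mathcal O=\mathbb C\{x_1,\dots,x_m\}$ be the ring of convergent power series with maximal ideal $\mathfrak m$, and let $M$ be an $(n+1)\times n$ matrix with entries in $\mathfrak m$. Let $I\subset\mathcal O$ be the ideal generated by the maximal minors of $M$ and let $(X,0)\subset(\mathbb C^m,0)$ be the germ defined by $I$. Suppose that 1. $(X,0)$ has codimension $2$, i.e. $I$ has height $2$, and embedding dimension $m$, i.e. $I\subset\mathfrak m^2$ (this is automatic if $n\ge 2$); 2. $(X,0)$ is an isolated singularity: the ideal of its singular locus, generated by $I$ and all $2\times 2$ minors $\frac{\partial f}{\partial x_a}\frac{\partial g}{\partial x_b}-\frac{\partial f}{\partial x_b}\frac{\partial g}{\partial x_a}$ with $f,g\in I$, contains a power of $\mathfrak m$; 3. $(X,0)$ is simple: for every $r\ge 0$ and every matrix $F(t,x)$ whose entries are holomorphic near $(0,0)\in\mathbb C^r\times\mathbb C^m$ and which satisfies $F(0,x)=M(x)$, there is a neighbourhood $U$ of $(0,0)$ such that, for $(t,x)\in U$ with $x\in X_t$, where $X_t$ is defined by the maximal minors of $F(t,\cdot)$,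 only finitely many isomorphism classes of germs $(X_t,x)$ occur (germs are isomorphic when their local rings are isomorphic as $\mathbb C$-algebras). Then $n<3$ and $m<7$. -/

import Mathlib

open scoped Topology

namespace CMTwo

noncomputable section

/-- The algebra of complex valued functions on `ℂ^m` that are holomorphic in some neighbourhood
of `p`. -/
def holomorphicAt {m : ℕ} (p : Fin m → ℂ) : Subalgebra ℂ ((Fin m → ℂ) → ℂ) where
  carrier := {f | AnalyticAt ℂ f p}
  mul_mem' := fun hf hg => hf.mul hg
  add_mem' := fun hf hg => hf.add hg
  algebraMap_mem' := fun _ => analyticAt_const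

/-- The functions, holomorphic near `p`, whose germ at `p` is zero. -/
def zeroGerm {m : ℕ} (p : Fin m → ℂ) : Ideal (holomorphicAt p) where
  carrier := {f | ∀ᶠ x in 𝓝 p, f.1 x = 0}
  zero_mem' := Filter.Eventually.of_forall fun _ => rfl
  add_mem' := fun {f g} hf hg => by
    filter_upwards [hf, hg] with x h1 h2
    change f.1 x + g.1 x = 0
    rw [h1, h2, add_zero]
  smul_mem' := fun c f hf => by
    filter_upwards [hf] with x h1
    change c.1 x * f.1 x = 0
    rw [h1, mul_zero]

/-- The local ring `𝒪_{ℂ^m,p}` of germs at `p` of holomorphic functions; for `p = 0` this is the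
ring `ℂ{x₁,…,x_m}` of convergent power series. -/
def LocalRingAt {m : ℕ} (p : Fin m → ℂ) : Type :=
  holomorphicAt p ⧸ zeroGerm p

instance instCommRing {m : ℕ} (p : Fin m → ℂ) : CommRing (LocalRingAt p) :=
  inferInstanceAs (CommRing (holomorphicAt p ⧸ zeroGerm p))

instance instAlgebra {m : ℕ} (p : Fin m → ℂ) : Algebra ℂ (LocalRingAt p) :=
  inferInstanceAs (Algebra ℂ (holomorphicAt p ⧸ zeroGerm p))

/-- The homomorphism that takes a function, holomorphic near `p`, to its germ at `p`. -/
def mkGerm {m : ℕ} (p : Fin m → ℂ) : holomorphicAt p →ₐ[ℂ] LocalRingAt p :=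
  Ideal.Quotient.mkₐ ℂ (zeroGerm p)

theorem mem_holomorphicAt {m : ℕ} {p : Fin m → ℂ} {f : (Fin m → ℂ) → ℂ} :
    f ∈ holomorphicAt p ↔ AnalyticAt ℂ f p :=
  Iff.rfl

theorem mkGerm_eq_mkGerm_iff {m : ℕ} {p : Fin m → ℂ} {f g : holomorphicAt p} :
    mkGerm p f = mkGerm p g ↔ ∀ᶠ x in 𝓝 p, f.1 x = g.1 x := by
  refine (Ideal.Quotient.eq (I := zeroGerm p)).trans ?_
  change (∀ᶠ x in 𝓝 p, f.1 x - g.1 x = 0) ↔ _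
  simp only [sub_eq_zero]

open Classical in
/-- The germ at `p` of a function that is holomorphic near `p` (and `0` for any other function). -/
def germ {m : ℕ} (p : Fin m → ℂ) (f : (Fin m → ℂ) → ℂ) : LocalRingAt p :=
  if hf : f ∈ holomorphicAt p then mkGerm p ⟨f, hf⟩ else 0

/-- The value of a germ at its base point, as a ring homomorphism. -/
def evalGerm {m : ℕ} (p : Fin m → ℂ) : LocalRingAt p →+* ℂ :=
  Ideal.Quotient.lift (zeroGerm p)
    ((Pi.evalRingHom (fun _ : Fin m → ℂ => ℂ) p).comp (holomorphicAt p).val.toRingHom)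
    (fun f (hf : ∀ᶠ x in 𝓝 p, f.1 x = 0) => hf.self_of_nhds)

/-- The maximal ideal of `𝒪_{ℂ^m,p}`: the germs that vanish at `p`. -/
def maxIdeal {m : ℕ} (p : Fin m → ℂ) : Ideal (LocalRingAt p) :=
  RingHom.ker (evalGerm p)

/-- A holomorphic function that represents a given germ. -/
def repr {m : ℕ} {p : Fin m → ℂ} (g : LocalRingAt p) : (Fin m → ℂ) → ℂ :=
  (Quotient.out g : holomorphicAt p).1

/-- The partial derivative `∂g/∂x_a` of a germ `g`, computed on a representative. It does not
depend on the representative, see `pderiv_germ`. -/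
def pderiv {m : ℕ} {p : Fin m → ℂ} (a : Fin m) (g : LocalRingAt p) : LocalRingAt p :=
  germ p (fun x => fderiv ℂ (repr g) x (Pi.single a 1))

theorem analyticAt_repr {m : ℕ} {p : Fin m → ℂ} (g : LocalRingAt p) :
    AnalyticAt ℂ (repr g) p :=
  (Quotient.out g : holomorphicAt p).2

theorem germ_eq_germ_iff {m : ℕ} {p : Fin m → ℂ} {f g : (Fin m → ℂ) → ℂ}
    (hf : AnalyticAt ℂ f p) (hg : AnalyticAt ℂ g p) :
    germ p f = germ p g ↔ ∀ᶠ x in 𝓝 p, f x = g x := by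
  rw [germ, germ, dif_pos (mem_holomorphicAt.2 hf), dif_pos (mem_holomorphicAt.2 hg),
    mkGerm_eq_mkGerm_iff]

theorem germ_repr {m : ℕ} {p : Fin m → ℂ} (g : LocalRingAt p) : germ p (repr g) = g := by
  rw [germ, dif_pos (mem_holomorphicAt.2 (analyticAt_repr g))]
  exact Quotient.out_eq g

theorem pderiv_germ {m : ℕ} {p : Fin m → ℂ} (a : Fin m) {f : (Fin m → ℂ) → ℂ}
    (hf : AnalyticAt ℂ f p) :
    pderiv a (germ p f) = germ p (fun x => fderiv ℂ f x (Pi.single a 1)) := by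
  have key : ∀ᶠ x in 𝓝 p, repr (germ p f) x = f x :=
    (germ_eq_germ_iff (analyticAt_repr _) hf).1 (germ_repr _)
  have an : ∀ h : (Fin m → ℂ) → ℂ, AnalyticAt ℂ h p →
      AnalyticAt ℂ (fun x => fderiv ℂ h x (Pi.single a 1)) p := fun h hh =>
    (ContinuousLinearMap.apply ℂ ℂ (Pi.single a 1 : Fin m → ℂ)).analyticAt _ |>.comp hh.fderiv
  refine (germ_eq_germ_iff (an _ (analyticAt_repr _)) (an _ hf)).2 ?_
  filter_upwards [key.eventually_nhds] with x hx
  rw [Filter.EventuallyEq.fderiv_eq hx]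

/-- The ideal generated by the maximal minors of an `(n+1) × n` matrix. -/
def minorsIdeal {R : Type*} [CommRing R] {n : ℕ} (M : Matrix (Fin (n + 1)) (Fin n) R) : Ideal R :=
  Ideal.span (Set.range fun i : Fin (n + 1) => (M.submatrix i.succAbove id).det)

/-- The ideal of the singular locus of a germ of codimension 2 with ideal `I`: it is generated by
`I` and by the `2 × 2` minors of the Jacobian matrices of the elements of `I`. -/
def singularLocusIdeal {m : ℕ} {p : Fin m → ℂ} (I : Ideal (LocalRingAt p)) :
    Ideal (LocalRingAt p) :=
  I ⊔ Ideal.span {h | ∃ f ∈ I, ∃ g ∈ I, ∃ a b : Fin m,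
    h = pderiv a f * pderiv b g - pderiv b f * pderiv a g}

/-- The maximal minors of `M` define an isolated (Cohen-Macaulay) singularity of codimension 2 in
`(ℂ^m, 0)`, with embedding dimension `m`. -/
structure DefinesIsolatedCodimTwo {m n : ℕ}
    (M : Matrix (Fin (n + 1)) (Fin n) (LocalRingAt (0 : Fin m → ℂ))) : Prop where
  /-- The germ has codimension 2. -/
  codim_two : (minorsIdeal M).height = 2
  /-- The germ is not contained in a smooth hypersurface germ. -/
  embedding_dim : minorsIdeal M ≤ maxIdeal (0 : Fin m → ℂ) ^ 2
  /-- The singular locus is zero-dimensional (or empty). -/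
  isolated : ∃ k : ℕ, maxIdeal (0 : Fin m → ℂ) ^ k ≤ singularLocusIdeal (minorsIdeal M)

/-- The matrix of germs at `p` of a matrix of functions. -/
def germMatrix {m n : ℕ} (p : Fin m → ℂ)
    (A : (Fin m → ℂ) → Matrix (Fin (n + 1)) (Fin n) ℂ) :
    Matrix (Fin (n + 1)) (Fin n) (LocalRingAt p) :=
  Matrix.of fun i j => germ p (fun x => A x i j)

/-- A deformation of the germ defined by `M`, over the base `(ℂ^r, 0)`: a perturbation of the
presentation matrix, that is, a matrix `F t x` whose entries are jointly holomorphic near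
`(t, x) = (0, 0)` and which gives `M` for `t = 0`. -/
structure IsDeformation {m n r : ℕ}
    (M : Matrix (Fin (n + 1)) (Fin n) (LocalRingAt (0 : Fin m → ℂ)))
    (F : (Fin r → ℂ) → (Fin m → ℂ) → Matrix (Fin (n + 1)) (Fin n) ℂ) : Prop where
  holomorphic : ∀ i j, AnalyticAt ℂ (fun z : (Fin r → ℂ) × (Fin m → ℂ) => F z.1 z.2 i j) 0
  special_fibre : germMatrix 0 (F 0) = M

/-- The point `x` lies on the fibre `X_t` of the deformation `F`: all maximal minors of `F t x`
vanish. -/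
def MemFibre {m n r : ℕ} (F : (Fin r → ℂ) → (Fin m → ℂ) → Matrix (Fin (n + 1)) (Fin n) ℂ)
    (z : (Fin r → ℂ) × (Fin m → ℂ)) : Prop :=
  minorsIdeal (F z.1 z.2) = ⊥

/-- The local ring `𝒪_{X_t,x}` at a point `z = (t, x)` of the fibre `X_t` of the deformation. -/
abbrev FibreRing {m n r : ℕ} (F : (Fin r → ℂ) → (Fin m → ℂ) → Matrix (Fin (n + 1)) (Fin n) ℂ)
    (z : (Fin r → ℂ) × (Fin m → ℂ)) : Type :=
  LocalRingAt z.2 ⧸ minorsIdeal (germMatrix z.2 (F z.1))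

/-- The singularity defined by `M` is simple: each of its deformations has, at the points of the
fibres close to the origin, only finitely many germs `(X_t, x)` up to isomorphism. The finitely
many isomorphism classes are given by representatives; two germs are isomorphic when their local
rings are isomorphic as `ℂ`-algebras. -/
def IsSimpleSingularity {m n : ℕ}
    (M : Matrix (Fin (n + 1)) (Fin n) (LocalRingAt (0 : Fin m → ℂ))) : Prop :=
  ∀ (r : ℕ) (F : (Fin r → ℂ) → (Fin m → ℂ) → Matrix (Fin (n + 1)) (Fin n) ℂ),
    IsDeformation M F →
      ∃ S : Set ((Fin r → ℂ) × (Fin m → ℂ)), S.Finite ∧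
        ∀ᶠ z in 𝓝 (0 : (Fin r → ℂ) × (Fin m → ℂ)), MemFibre F z →
          ∃ s ∈ S, Nonempty (FibreRing F z ≃ₐ[ℂ] FibreRing F s)

end

end CMTwo

namespace CMTwo

noncomputable section

/-! ### Calculus of germs and their values. -/

section Germs

variable {m : ℕ} {p : Fin m → ℂ}

/-! For `n = 0` the only maximal minor is 1, which does not lie in 𝔪². The other cases rest on two
dimension counts against simplicity and one against isolatedness.

Simplicity. An isomorphism of two quotients of 𝒪, by ideals whose generators have initial forms of
the same degree `d ≥ 2`, has an invertible linear part `A`. It relates the initial forms by `A` and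
by constant linear combinations (`exists_linear_of_algEquiv`). In a family that perturbs the leading
coefficients of `M`, simplicity leaves finitely many classes at the origin
(`IsSimpleSingularity.exists_finite`). Hence finitely many analytic images of spaces of equivalences
would cover an open set of coefficients, which is impossible when these spaces have smaller
dimension (`exists_mem_notMem_range`). For `n = 1` both entries lie in 𝔪². Pairs of quadratic forms
have `m(m+1)` coefficients, equivalences only `m² + 4` parameters, which excludes `m ≥ 5`. For `n ≥
3` and `3 ≤ m ≤ 6` the linear part of `M` has `n(n+1)m` coefficients. The maximal minors of a
general linear matrix have no syzygies of degree at most one except combinations of its columns, as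
in the Hilbert–Burch theorem. So the minors determine the matrix up to constant factors on both
sides (`IsGeneral.exists_eq`), and equivalences `T(x) = D S(Ax) C` have only `m² + (n+1)² + n²`
parameters.

Isolatedness, for `n ≥ 2`. Derivatives of maximal minors are combinations of minors of size `n - 1`,
so the singular locus contains the locus of rank at most `n - 2`, whose expected codimension is `3 ·
2 = 6`. For `m ≥ 7` it cannot be only the origin (`not_maxIdeal_pow_le_lowMinors`). The proof
compares growth rates. Intersect ℂ^m times the cone of low rank matrices with the graph of `M`, cut
out by one equation per matrix entry. If the intersection were concentrated at the origin, the cone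
would have Hilbert function of degree at most the number `E` of entries. But monomials in `m`
coordinates and at least `E - 6` matrix entries are independent on it. -/

theorem germ_eq_mkGerm {f : (Fin m → ℂ) → ℂ} (hf : AnalyticAt ℂ f p) :
    germ p f = mkGerm p ⟨f, hf⟩ :=
  dif_pos (mem_holomorphicAt.2 hf)

theorem germ_congr {f g : (Fin m → ℂ) → ℂ} (hf : AnalyticAt ℂ f p)
    (h : ∀ᶠ x in 𝓝 p, f x = g x) : germ p f = germ p g :=
  (germ_eq_germ_iff hf (hf.congr h)).2 h

theorem exists_germ_eq (g : LocalRingAt p) : ∃ f, AnalyticAt ℂ f p ∧ germ p f = g :=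
  ⟨repr g, analyticAt_repr g, germ_repr g⟩

theorem germ_add {f g : (Fin m → ℂ) → ℂ} (hf : AnalyticAt ℂ f p) (hg : AnalyticAt ℂ g p) :
    germ p (fun x => f x + g x) = germ p f + germ p g := by
  rw [germ_eq_mkGerm hf, germ_eq_mkGerm hg, ← map_add]
  exact germ_eq_mkGerm (hf.add hg)

theorem germ_mul {f g : (Fin m → ℂ) → ℂ} (hf : AnalyticAt ℂ f p) (hg : AnalyticAt ℂ g p) :
    germ p (fun x => f x * g x) = germ p f * germ p g := by
  rw [germ_eq_mkGerm hf, germ_eq_mkGerm hg, ← map_mul]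
  exact germ_eq_mkGerm (hf.mul hg)

theorem germ_const (c : ℂ) : germ p (fun _ => c) = algebraMap ℂ (LocalRingAt p) c := by
  rw [germ_eq_mkGerm analyticAt_const, ← (mkGerm p).commutes c]
  rfl

theorem germ_zero : germ p (fun _ => (0 : ℂ)) = 0 := by
  rw [germ_const, map_zero]

theorem germ_sum {ι : Type*} (s : Finset ι) {f : ι → (Fin m → ℂ) → ℂ}
    (hf : ∀ i, AnalyticAt ℂ (f i) p) :
    germ p (fun x => ∑ i ∈ s, f i x) = ∑ i ∈ s, germ p (f i) := by
  classical
  induction s using Finset.induction_on with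
  | empty => simpa using germ_zero (p := p)
  | insert a s ha ih =>
    simp only [Finset.sum_insert ha]
    rw [← ih, germ_add (hf a)]
    exact Finset.analyticAt_fun_sum s fun i _ => hf i

theorem evalGerm_germ {f : (Fin m → ℂ) → ℂ} (hf : AnalyticAt ℂ f p) :
    evalGerm p (germ p f) = f p := by
  rw [germ_eq_mkGerm hf]
  rfl

theorem evalGerm_algebraMap (c : ℂ) : evalGerm p (algebraMap ℂ (LocalRingAt p) c) = c := by
  rw [← germ_const, evalGerm_germ analyticAt_const]

theorem mem_maxIdeal {g : LocalRingAt p} : g ∈ maxIdeal p ↔ evalGerm p g = 0 :=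
  RingHom.mem_ker

theorem isUnit_of_evalGerm_ne_zero {g : LocalRingAt p} (hg : evalGerm p g ≠ 0) : IsUnit g := by
  obtain ⟨f, hf, rfl⟩ := exists_germ_eq g
  rw [evalGerm_germ hf] at hg
  refine IsUnit.of_mul_eq_one (germ p fun x => (f x)⁻¹) ?_
  have hinv : AnalyticAt ℂ (fun x => (f x)⁻¹) p := hf.inv hg
  rw [← germ_mul hf hinv, ← map_one (algebraMap ℂ (LocalRingAt p)), ← germ_const]
  refine germ_congr (hf.mul hinv) ?_
  filter_upwards [hf.continuousAt.eventually_ne hg] with x hx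
  exact mul_inv_cancel₀ hx

theorem sub_algebraMap_evalGerm_mem (g : LocalRingAt p) :
    g - algebraMap ℂ _ (evalGerm p g) ∈ maxIdeal p := by
  rw [mem_maxIdeal, map_sub, evalGerm_algebraMap, sub_self]

end Germs

/-! ### Hadamard's lemma and generators of the maximal ideal. -/

section Coordinates

variable {m : ℕ}

theorem analyticAt_coord (a : Fin m) (p : Fin m → ℂ) :
    AnalyticAt ℂ (fun x : Fin m → ℂ => x a) p :=
  (ContinuousLinearMap.proj (R := ℂ) (φ := fun _ : Fin m => ℂ) a).analyticAt p

/-- The germ at the origin of a coordinate function. -/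
def coord (a : Fin m) : LocalRingAt (0 : Fin m → ℂ) :=
  germ 0 fun x => x a

theorem coord_mem (a : Fin m) : coord a ∈ maxIdeal (0 : Fin m → ℂ) := by
  rw [mem_maxIdeal, coord, evalGerm_germ (analyticAt_coord a 0)]
  rfl

/-- Hadamard's lemma: an analytic function differs from its value at the origin by a combination of
the coordinates with analytic coefficients. -/
theorem exists_eq_add_sum_mul {f : (Fin m → ℂ) → ℂ} (hf : AnalyticAt ℂ f 0) :
    ∃ g : Fin m → (Fin m → ℂ) → ℂ, (∀ a, AnalyticAt ℂ (g a) 0) ∧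
      ∀ᶠ x in 𝓝 0, f x = f 0 + ∑ a, x a * g a x := by
  obtain ⟨P, r, hP⟩ := hf
  have hrad : 0 < P.shift.radius := by
    rw [FormalMultilinearSeries.radius_shift]
    exact hP.r_pos.trans_le hP.r_le
  have hs := P.shift.hasFPowerSeriesOnBall hrad
  -- `P.shift` sums to a function with values in the linear forms, such that `f x - f 0` is its
  -- value at `x` applied to `x`. The coefficients of these linear forms are the required functions.
  refine ⟨fun a x => P.shift.sum x (Pi.single a 1), fun a => ?_, ?_⟩
  · exact ((ContinuousLinearMap.apply ℂ ℂ (Pi.single a 1 : Fin m → ℂ)).analyticAt _).comp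
      hs.analyticAt
  · filter_upwards [Metric.eball_mem_nhds (0 : Fin m → ℂ) hP.r_pos,
      Metric.eball_mem_nhds (0 : Fin m → ℂ) hrad] with x hx hx'
    have h1 := hP.hasSum hx
    have h2 := hs.hasSum hx'
    rw [zero_add] at h1 h2
    have h3 : HasSum (fun n => P (n + 1) fun _ => x) (P.shift.sum x x) := by
      have h3 := h2.mapL (ContinuousLinearMap.apply ℂ ℂ x)
      have h4 : ∀ n, Fin.snoc (α := fun _ : Fin (n + 1) => Fin m → ℂ) (fun _ => x) x =
          fun _ => x := fun n => by
        ext i : 1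
        refine Fin.lastCases ?_ (fun i => ?_) i <;> simp
      simpa [FormalMultilinearSeries.shift, h4] using h3
    have h4 := (hasSum_nat_add_iff' 1).2 h1
    have h5 := h4.unique h3
    have h6 : P 0 (fun _ => x) = f 0 := by
      have := hP.coeff_zero (fun _ => x)
      exact this
    simp only [Finset.range_one, Finset.sum_singleton, h6] at h5
    rw [← sub_eq_iff_eq_add', h5]
    calc P.shift.sum x x = P.shift.sum x (∑ a, x a • Pi.single a 1) := by
          congr 1
          ext b
          simp [Finset.sum_apply, Pi.single_apply]
      _ = _ := by simp only [map_sum, map_smul, smul_eq_mul]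

theorem maxIdeal_eq_span : maxIdeal (0 : Fin m → ℂ) = Ideal.span (Set.range coord) := by
  refine le_antisymm (fun g hg => ?_) (Ideal.span_le.2 ?_)
  · obtain ⟨f, hf, rfl⟩ := exists_germ_eq g
    rw [mem_maxIdeal, evalGerm_germ hf] at hg
    obtain ⟨g, hg', h⟩ := exists_eq_add_sum_mul hf
    have : germ 0 f = ∑ a, coord a * germ 0 (g a) := by
      rw [germ_congr hf h, hg]
      simp only [zero_add]
      refine (germ_sum _ fun a => (analyticAt_coord a 0).mul (hg' a)).trans ?_
      exact Finset.sum_congr rfl fun a _ => germ_mul (analyticAt_coord a 0) (hg' a)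
    rw [this]
    exact Ideal.sum_mem _ fun a _ => Ideal.mul_mem_right _ _ (Ideal.subset_span ⟨a, rfl⟩)
  · rintro _ ⟨a, rfl⟩
    exact coord_mem a

end Coordinates

/-! ### Restriction to lines, which detects homogeneous leading forms. -/

section Lines

variable {m : ℕ}

theorem analyticAt_line (v : Fin m → ℂ) (s : Fin 1 → ℂ) :
    AnalyticAt ℂ (fun s : Fin 1 → ℂ => s 0 • v) s :=
  (analyticAt_coord 0 s).smul analyticAt_const

/-- Pull-back of a germ to the line spanned by `v`. -/
def lineHom (v : Fin m → ℂ) : LocalRingAt (0 : Fin m → ℂ) →ₐ[ℂ] LocalRingAt (0 : Fin 1 → ℂ) :=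
  Ideal.Quotient.liftₐ (zeroGerm 0)
    ((mkGerm 0).comp
      { toFun := fun f => ⟨fun s => f.1 (s 0 • v), by
          have hf : AnalyticAt ℂ f.1 0 := f.2
          refine AnalyticAt.fun_comp (g := f.1) ?_ (analyticAt_line v 0)
          simpa using hf⟩
        map_one' := rfl
        map_mul' := fun _ _ => rfl
        map_zero' := rfl
        map_add' := fun _ _ => rfl
        commutes' := fun _ => rfl })
    (fun f (hf : ∀ᶠ x in 𝓝 0, f.1 x = 0) => by
      have h0 := (analyticAt_line v 0).continuousAt.tendsto
      simp only [Pi.zero_apply, zero_smul] at h0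
      exact mkGerm_eq_mkGerm_iff.2 (h0.eventually hf))

theorem lineHom_germ (v : Fin m → ℂ) {f : (Fin m → ℂ) → ℂ} (hf : AnalyticAt ℂ f 0) :
    lineHom v (germ 0 f) = germ 0 fun s : Fin 1 → ℂ => f (s 0 • v) := by
  have h : AnalyticAt ℂ (fun s : Fin 1 → ℂ => f (s 0 • v)) 0 := by
    refine AnalyticAt.fun_comp (g := f) ?_ (analyticAt_line v 0)
    simpa using hf
  rw [germ_eq_mkGerm hf, germ_eq_mkGerm h]
  rfl

theorem lineHom_coord (v : Fin m → ℂ) (a : Fin m) : lineHom v (coord a) = v a • coord 0 := by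
  rw [coord, lineHom_germ v (analyticAt_coord a 0), Algebra.smul_def, ← germ_const, coord,
    ← germ_mul analyticAt_const (analyticAt_coord 0 0)]
  congr 1
  ext s
  simp [mul_comm]

/-- Away from the origin the coordinate cancels pointwise. A nonzero value at the origin would
persist nearby by continuity, against the vanishing at a point `ε / 2`. -/
theorem eq_zero_of_coord_mul_eq_zero {g : LocalRingAt (0 : Fin 1 → ℂ)} (h : coord 0 * g = 0) :
    g = 0 := by
  obtain ⟨f, hf, rfl⟩ := exists_germ_eq g
  have hmul := (analyticAt_coord (0 : Fin 1) 0).mul hf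
  rw [coord, ← germ_mul (analyticAt_coord 0 0) hf, ← germ_zero] at h
  replace h := (germ_eq_germ_iff hmul analyticAt_const).1 h
  rw [← germ_zero, germ_eq_germ_iff hf analyticAt_const]
  filter_upwards [h.eventually_nhds, hf.eventually_analyticAt] with s hs hfs
  by_cases h0 : s 0 = 0
  · have hs0 : s = 0 := by
      ext i
      rw [Subsingleton.elim i 0]
      exact h0
    subst hs0
    by_contra hne
    have h1 := hfs.continuousAt.eventually_ne hne
    obtain ⟨ε, hε, hball⟩ := Metric.eventually_nhds_iff.1 (hs.and h1)
    have h2 := @hball (fun _ => ((ε / 2 : ℝ) : ℂ)) (by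
      rw [dist_zero_right, pi_norm_lt_iff hε]
      intro _
      rw [Complex.norm_real, Real.norm_of_nonneg (by linarith)]
      linarith)
    rcases mul_eq_zero.1 h2.1 with h3 | h3
    · exact hε.ne' (by simpa using h3)
    · exact h2.2 h3
  · simpa [h0] using hs.self_of_nhds

theorem polynomial_eq_zero_of_aeval_coord_mem {P : Polynomial ℂ} {N : ℕ} (hP : P.natDegree < N)
    (h : Polynomial.aeval (coord (0 : Fin 1)) P ∈ Ideal.span {coord (0 : Fin 1)} ^ N) : P = 0 := by
  rw [Ideal.span_singleton_pow, Ideal.mem_span_singleton] at h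
  induction N generalizing P with
  | zero => omega
  | succ N ih =>
    have h0 : P.coeff 0 = 0 := by
      have h1 : evalGerm 0 (Polynomial.aeval (coord (0 : Fin 1)) P) = 0 := by
        obtain ⟨g, hg⟩ := h
        rw [hg, pow_succ', mul_assoc, map_mul, mem_maxIdeal.1 (coord_mem 0), zero_mul]
      rw [← Polynomial.divX_mul_X_add P] at h1
      simpa [mem_maxIdeal.1 (coord_mem (0 : Fin 1)), evalGerm_algebraMap] using h1
    have hdiv : P = P.divX * Polynomial.X := by
      conv_lhs => rw [← Polynomial.divX_mul_X_add P, h0, map_zero, add_zero]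
    rcases N.eq_zero_or_pos with rfl | hN
    · rw [Polynomial.eq_C_of_natDegree_eq_zero (by omega : P.natDegree = 0), h0, map_zero]
    · rw [hdiv, ih (P := P.divX) (by rw [Polynomial.natDegree_divX_eq_natDegree_tsub_one]; omega),
        zero_mul]
      obtain ⟨g, hg⟩ := h
      refine ⟨g, sub_eq_zero.1 (eq_zero_of_coord_mul_eq_zero ?_)⟩
      rw [hdiv, map_mul, Polynomial.aeval_X, pow_succ'] at hg
      linear_combination hg

theorem map_lineHom_maxIdeal_pow_le (v : Fin m → ℂ) (k : ℕ) :
    (maxIdeal (0 : Fin m → ℂ) ^ k).map (lineHom v) ≤ Ideal.span {coord (0 : Fin 1)} ^ k := by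
  rw [Ideal.map_pow]
  refine Ideal.pow_right_mono ?_ k
  rw [maxIdeal_eq_span, Ideal.map_span, Ideal.span_le]
  rintro _ ⟨_, ⟨a, rfl⟩, rfl⟩
  rw [lineHom_coord, Algebra.smul_def]
  exact Ideal.mul_mem_left _ _ (Ideal.mem_span_singleton_self _)

theorem _root_.MvPolynomial.IsHomogeneous.aeval_mul_left {σ S : Type*} [CommRing S] [Algebra ℂ S]
    {P : MvPolynomial σ ℂ} {d : ℕ} (hP : P.IsHomogeneous d) (z : S) (v : σ → S) :
    MvPolynomial.aeval (fun a => z * v a) P = z ^ d * MvPolynomial.aeval v P := by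
  simp only [MvPolynomial.aeval_def, MvPolynomial.eval₂_eq, Finset.mul_sum]
  refine Finset.sum_congr rfl fun s hs => ?_
  have hd : ∑ i ∈ s.support, s i = d := by
    have := hP (MvPolynomial.mem_support_iff.1 hs)
    simpa [Finsupp.weight_apply, Finsupp.sum] using this
  simp only [mul_pow, Finset.prod_mul_distrib, Finset.prod_pow_eq_pow_sum, hd]
  ring

/-- On the line through `v` the form becomes `P(v) z ^ d`, which is divisible by `z ^ (d + 1)` only
if `P(v) = 0`. This makes initial forms well defined without power series expansions. -/
theorem eval_eq_zero_of_aeval_coord_mem {P : MvPolynomial (Fin m) ℂ} {d : ℕ}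
    (hP : P.IsHomogeneous d) (h : MvPolynomial.aeval coord P ∈ maxIdeal (0 : Fin m → ℂ) ^ (d + 1))
    (v : Fin m → ℂ) : MvPolynomial.eval v P = 0 := by
  have h1 := map_lineHom_maxIdeal_pow_le v _ (Ideal.mem_map_of_mem (lineHom v) h)
  have h2 : lineHom v (MvPolynomial.aeval coord P) = Polynomial.aeval (coord (0 : Fin 1))
      (Polynomial.C (MvPolynomial.eval v P) * Polynomial.X ^ d) := by
    have h3 : (fun a => lineHom v (coord a)) =
        fun a => coord 0 * algebraMap ℂ (LocalRingAt (0 : Fin 1 → ℂ)) (v a) := by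
      ext a
      rw [lineHom_coord, Algebra.smul_def, mul_comm]
    rw [← AlgHom.comp_apply, MvPolynomial.comp_aeval, h3, hP.aeval_mul_left]
    change _ * MvPolynomial.aeval (algebraMap ℂ _ ∘ v) P = _
    rw [MvPolynomial.aeval_algebraMap_apply]
    rw [map_mul, Polynomial.aeval_C, map_pow, Polynomial.aeval_X, mul_comm,
      MvPolynomial.aeval_eq_eval]
  change lineHom v (MvPolynomial.aeval coord P) ∈ _ at h1
  rw [h2] at h1
  have h3 := polynomial_eq_zero_of_aeval_coord_mem
    (Nat.lt_succ_of_le (Polynomial.natDegree_C_mul_X_pow_le _ _)) h1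
  simpa using congrArg (fun Q => Polynomial.coeff Q d) h3

end Lines

/-! ### Leading terms of products, polynomials and determinants. -/

section Congruences

variable {R : Type*} [CommRing R] {𝔞 : Ideal R}

theorem mul_sub_mul_mem {u v u' v' : R} {k l : ℕ} (hu : u ∈ 𝔞 ^ k) (hv' : v' ∈ 𝔞 ^ l)
    (h : u - v ∈ 𝔞 ^ (k + 1)) (h' : u' - v' ∈ 𝔞 ^ (l + 1)) :
    u * u' - v * v' ∈ 𝔞 ^ (k + l + 1) := by
  have h1 : u * u' - v * v' = u * (u' - v') + (u - v) * v' := by ring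
  rw [h1]
  refine Ideal.add_mem _ ?_ ?_
  · rw [add_assoc, pow_add]
    exact Ideal.mul_mem_mul hu h'
  · rw [add_right_comm, pow_add]
    exact Ideal.mul_mem_mul h hv'

theorem prod_sub_prod_mem {ι : Type*} (s : Finset ι) {u v : ι → R} {k : ι → ℕ}
    (hu : ∀ i, u i ∈ 𝔞 ^ k i) (hv : ∀ i, v i ∈ 𝔞 ^ k i) (h : ∀ i, u i - v i ∈ 𝔞 ^ (k i + 1)) :
    ∏ i ∈ s, u i - ∏ i ∈ s, v i ∈ 𝔞 ^ (∑ i ∈ s, k i + 1) := by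
  classical
  induction s using Finset.induction_on with
  | empty => simp
  | insert a s ha ih =>
    rw [Finset.prod_insert ha, Finset.prod_insert ha, Finset.sum_insert ha]
    refine mul_sub_mul_mem (hu a) ?_ (h a) ih
    rw [← Finset.prod_pow_eq_pow_sum]
    exact Ideal.prod_mem_prod fun i _ => hv i

theorem pow_sub_pow_mem {u v : R} (hu : u ∈ 𝔞) (hv : v ∈ 𝔞) (h : u - v ∈ 𝔞 ^ 2) (k : ℕ) :
    u ^ k - v ^ k ∈ 𝔞 ^ (k + 1) := by
  simpa using prod_sub_prod_mem (Finset.range k) (u := fun _ => u) (v := fun _ => v)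
    (k := fun _ => 1) (by simpa using hu) (by simpa using hv) (by simpa using h)

theorem aeval_sub_aeval_mem {σ : Type*} [Algebra ℂ R] {P : MvPolynomial σ ℂ} {d : ℕ}
    (hP : P.IsHomogeneous d) {u v : σ → R} (hu : ∀ a, u a ∈ 𝔞) (hv : ∀ a, v a ∈ 𝔞)
    (h : ∀ a, u a - v a ∈ 𝔞 ^ 2) :
    MvPolynomial.aeval u P - MvPolynomial.aeval v P ∈ 𝔞 ^ (d + 1) := by
  simp only [MvPolynomial.aeval_def, MvPolynomial.eval₂_eq, ← Finset.sum_sub_distrib, ← mul_sub]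
  refine Ideal.sum_mem _ fun s hs => Ideal.mul_mem_left _ _ ?_
  have hd : ∑ i ∈ s.support, s i = d := by
    have := hP (MvPolynomial.mem_support_iff.1 hs)
    simpa [Finsupp.weight_apply, Finsupp.sum] using this
  rw [← hd]
  exact prod_sub_prod_mem _ (fun i => Ideal.pow_mem_pow (hu i) _)
    (fun i => Ideal.pow_mem_pow (hv i) _) fun i => pow_sub_pow_mem (hu i) (hv i) (h i) _

theorem det_sub_det_mem {n : ℕ} {N N' : Matrix (Fin n) (Fin n) R} (hN : ∀ i j, N i j ∈ 𝔞)
    (hN' : ∀ i j, N' i j ∈ 𝔞) (h : ∀ i j, N i j - N' i j ∈ 𝔞 ^ 2) :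
    N.det - N'.det ∈ 𝔞 ^ (n + 1) := by
  rw [Matrix.det_apply, Matrix.det_apply, ← Finset.sum_sub_distrib]
  refine Ideal.sum_mem _ fun σ _ => ?_
  rw [← smul_sub, Units.smul_def]
  refine zsmul_mem ?_ _
  have := prod_sub_prod_mem Finset.univ (u := fun i => N (σ i) i) (v := fun i => N' (σ i) i)
    (k := fun _ => 1) (𝔞 := 𝔞) (fun i => by simpa using hN _ _) (fun i => by simpa using hN' _ _)
    (fun i => by simpa using h _ _)
  simpa using this

theorem det_mem_pow {n : ℕ} {N : Matrix (Fin n) (Fin n) R} (hN : ∀ i j, N i j ∈ 𝔞) :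
    N.det ∈ 𝔞 ^ n := by
  rw [Matrix.det_apply]
  refine Ideal.sum_mem _ fun σ _ => ?_
  rw [Units.smul_def]
  refine zsmul_mem ?_ _
  have := Ideal.prod_mem_prod (s := Finset.univ) (I := fun _ => 𝔞) (x := fun i => N (σ i) i)
    fun i _ => hN _ _
  simpa using this

end Congruences

/-! ### Isomorphisms of local rings act linearly on initial forms. -/

section Isomorphisms

variable {m : ℕ}

local notation "𝔪" => maxIdeal (0 : Fin m → ℂ)
local notation "𝒪" => LocalRingAt (0 : Fin m → ℂ)

theorem exists_sub_sum_coord_mem {g : 𝒪} (hg : g ∈ 𝔪) :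
    ∃ c : Fin m → ℂ, g - ∑ a, c a • coord a ∈ 𝔪 ^ 2 := by
  have hg' := hg
  rw [maxIdeal_eq_span, Ideal.mem_span_range_iff_exists_fun] at hg'
  obtain ⟨u, rfl⟩ := hg'
  refine ⟨fun a => evalGerm 0 (u a), ?_⟩
  rw [← Finset.sum_sub_distrib]
  refine Ideal.sum_mem _ fun a _ => ?_
  rw [Algebra.smul_def, ← sub_mul, pow_two]
  exact Ideal.mul_mem_mul (sub_algebraMap_evalGerm_mem _) (coord_mem a)

theorem sum_coord_mem (c : Fin m → ℂ) : ∑ a, c a • coord a ∈ 𝔪 :=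
  Ideal.sum_mem _ fun a _ => by
    rw [Algebra.smul_def]
    exact Ideal.mul_mem_left _ _ (coord_mem a)

/-- Coordinates are linearly independent modulo the square of the maximal ideal. -/
theorem eq_zero_of_sum_coord_mem {c : Fin m → ℂ} (h : ∑ a, c a • coord a ∈ 𝔪 ^ 2) : c = 0 := by
  have h1 := eval_eq_zero_of_aeval_coord_mem (d := 1)
    (P := ∑ a, MvPolynomial.C (c a) * MvPolynomial.X a)
    (MvPolynomial.IsHomogeneous.sum _ _ _ fun a _ => (MvPolynomial.isHomogeneous_X ℂ a).C_mul _)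
    (by simpa [Algebra.smul_def] using h)
  ext a
  simpa [Pi.single_apply] using h1 (Pi.single a 1)

/-- Algebra homomorphisms between these rings are local: if `g` had value `c ≠ 0`, then `f - c`
would be a unit while its image, the class of `g - c`, is not. -/
theorem mem_maxIdeal_of_algHom {I I' : Ideal 𝒪} (hI' : I' ≤ 𝔪) (Φ : (𝒪 ⧸ I) →ₐ[ℂ] (𝒪 ⧸ I'))
    {f g : 𝒪} (hf : f ∈ 𝔪)
    (hg : Ideal.Quotient.mk I' g = Φ (Ideal.Quotient.mk I f)) : g ∈ 𝔪 := by
  rw [mem_maxIdeal]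
  by_contra hne
  set c := evalGerm 0 g with hc
  have hu : IsUnit (f - algebraMap ℂ 𝒪 c) := by
    refine isUnit_of_evalGerm_ne_zero ?_
    rw [map_sub, mem_maxIdeal.1 hf, evalGerm_algebraMap, zero_sub]
    exact neg_ne_zero.2 hne
  have h1 := (hu.map (Ideal.Quotient.mk I)).map Φ
  have h2 : Φ (Ideal.Quotient.mk I (f - algebraMap ℂ 𝒪 c)) =
      Ideal.Quotient.mk I' (g - algebraMap ℂ 𝒪 c) := by
    have : Φ (Ideal.Quotient.mk I (algebraMap ℂ 𝒪 c)) =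
        Ideal.Quotient.mk I' (algebraMap ℂ 𝒪 c) := Φ.commutes c
    rw [map_sub, map_sub, map_sub, hg, this]
  rw [h2] at h1
  obtain ⟨w, hw⟩ := Ideal.Quotient.mk_surjective (I := I') (h1.unit⁻¹ : (𝒪 ⧸ I')ˣ).1
  have h3 : Ideal.Quotient.mk I' ((g - algebraMap ℂ 𝒪 c) * w) = Ideal.Quotient.mk I' 1 := by
    rw [map_mul, hw, map_one]
    exact h1.mul_val_inv
  have h4 := hI' (Ideal.Quotient.eq.1 h3)
  rw [mem_maxIdeal, map_sub, map_mul, mem_maxIdeal.1 (sub_algebraMap_evalGerm_mem g)] at h4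
  simp at h4

theorem map_maxIdeal_pow_le {I I' : Ideal 𝒪} (hI' : I' ≤ 𝔪) (Φ : (𝒪 ⧸ I) →ₐ[ℂ] (𝒪 ⧸ I'))
    {f g : 𝒪} {k : ℕ} (hf : f ∈ 𝔪 ^ k)
    (hg : Ideal.Quotient.mk I' g = Φ (Ideal.Quotient.mk I f)) : g ∈ 𝔪 ^ k ⊔ I' := by
  have h1 : (Ideal.map (Ideal.Quotient.mk I) 𝔪).map Φ ≤ Ideal.map (Ideal.Quotient.mk I') 𝔪 := by
    rw [Ideal.map_le_iff_le_comap, Ideal.map_le_iff_le_comap]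
    intro u hu
    obtain ⟨w, hw⟩ := Ideal.Quotient.mk_surjective (I := I') (Φ (Ideal.Quotient.mk I u))
    have := Ideal.mem_map_of_mem (Ideal.Quotient.mk I') (mem_maxIdeal_of_algHom hI' Φ hu hw)
    rw [hw] at this
    exact this
  have h2 : Φ (Ideal.Quotient.mk I f) ∈ (𝔪 ^ k).map (Ideal.Quotient.mk I') := by
    rw [Ideal.map_pow]
    refine Ideal.pow_right_mono h1 k ?_
    rw [← Ideal.map_pow, ← Ideal.map_pow]
    exact Ideal.mem_map_of_mem _ (Ideal.mem_map_of_mem _ hf)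
  rw [← hg] at h2
  rw [← Ideal.mk_ker (I := I'), ← Ideal.comap_map_of_surjective' _ Ideal.Quotient.mk_surjective]
  exact h2

theorem exists_lift_coord {I I' : Ideal 𝒪} (hI' : I' ≤ 𝔪) (Φ : (𝒪 ⧸ I) →ₐ[ℂ] (𝒪 ⧸ I')) :
    ∃ (h : Fin m → 𝒪) (A : Matrix (Fin m) (Fin m) ℂ), (∀ a, h a ∈ 𝔪) ∧
      (∀ a, Ideal.Quotient.mk I' (h a) = Φ (Ideal.Quotient.mk I (coord a))) ∧
      ∀ a, h a - ∑ b, A a b • coord b ∈ 𝔪 ^ 2 := by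
  choose h hh using fun a =>
    Ideal.Quotient.mk_surjective (I := I') (Φ (Ideal.Quotient.mk I (coord a)))
  have hmem : ∀ a, h a ∈ 𝔪 := fun a => mem_maxIdeal_of_algHom hI' Φ (coord_mem a) (hh a)
  choose A hA using fun a => exists_sub_sum_coord_mem (hmem a)
  exact ⟨h, A, hmem, hh, hA⟩

/-- An isomorphism between the quotients of the ring of convergent power series by two ideals whose
generators have initial forms of the same degree `d ≥ 2` relates these initial forms by a linear
change of coordinates and linear combinations. -/
theorem exists_linear_of_algEquiv {d k : ℕ} (hd : 2 ≤ d) {δ δ' : Fin k → 𝒪}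
    {P P' : Fin k → MvPolynomial (Fin m) ℂ} (hP : ∀ i, (P i).IsHomogeneous d)
    (hP' : ∀ i, (P' i).IsHomogeneous d) (hδ : ∀ i, δ i ∈ 𝔪 ^ d) (hδ' : ∀ i, δ' i ∈ 𝔪 ^ d)
    (h : ∀ i, δ i - MvPolynomial.aeval coord (P i) ∈ 𝔪 ^ (d + 1))
    (h' : ∀ i, δ' i - MvPolynomial.aeval coord (P' i) ∈ 𝔪 ^ (d + 1))
    (e : (𝒪 ⧸ Ideal.span (Set.range δ)) ≃ₐ[ℂ] (𝒪 ⧸ Ideal.span (Set.range δ'))) :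
    ∃ (A : Matrix (Fin m) (Fin m) ℂ) (B : Matrix (Fin k) (Fin k) ℂ), IsUnit A ∧
      ∀ i x, MvPolynomial.eval x (P i) = ∑ j, B i j * MvPolynomial.eval (A.mulVec x) (P' j) := by
  set I := Ideal.span (Set.range δ) with hI
  set I' := Ideal.span (Set.range δ') with hI'
  have hId : I' ≤ 𝔪 ^ d := by
    rw [hI', Ideal.span_le]
    rintro _ ⟨i, rfl⟩
    exact hδ' i
  have hId0 : I ≤ 𝔪 ^ d := by
    rw [hI, Ideal.span_le]
    rintro _ ⟨i, rfl⟩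
    exact hδ i
  have hle : 𝔪 ^ d ≤ 𝔪 := Ideal.pow_le_self (by omega)
  obtain ⟨u, A, hu, hue, huA⟩ := exists_lift_coord (hId.trans hle) e.toAlgHom
  obtain ⟨w, A', hw, hwe, hwA⟩ := exists_lift_coord (hId0.trans hle) e.symm.toAlgHom
  -- Applying `e` to `w a ≡ ∑ A' a c • coord c` modulo 𝔪² gives `coord a ≡ ∑ A' a c • u c`, because
  -- `I' ≤ 𝔪²`. The coordinates are independent modulo 𝔪².
  have hAA : A' * A = 1 := by
    ext a b
    have h1 : coord a - ∑ c, A' a c • u c ∈ 𝔪 ^ 2 := by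
      have h2 := map_maxIdeal_pow_le (hId.trans hle) e.toAlgHom (hwA a)
        (g := coord a - ∑ c, A' a c • u c) ?_
      · exact sup_le le_rfl (hId.trans (Ideal.pow_le_pow_right hd)) h2
      · have h3 : ∀ f : 𝒪, e (Ideal.Quotient.mk I f) =
            (e.toAlgHom.comp (Ideal.Quotient.mkₐ ℂ I)) f := fun f => rfl
        have h4 : ∀ f : 𝒪, Ideal.Quotient.mk I' f = Ideal.Quotient.mkₐ ℂ I' f := fun f => rfl
        have h5 : e (Ideal.Quotient.mk I (w a)) = Ideal.Quotient.mk I' (coord a) := by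
          rw [hwe]
          exact e.apply_symm_apply _
        change _ = e _
        rw [h3, h4, map_sub, map_sub, ← h3, h5, map_sum, map_sum, ← h4]
        refine congrArg₂ _ rfl (Finset.sum_congr rfl fun c _ => ?_)
        rw [map_smul, map_smul, ← h3, ← h4]
        exact congrArg _ (hue c)
    have h2 : ∑ b, ((1 : Matrix (Fin m) (Fin m) ℂ) a b - (A' * A) a b) • coord b ∈ 𝔪 ^ 2 := by
      have h3 : ∑ c, A' a c • (u c - ∑ b, A c b • coord b) ∈ 𝔪 ^ 2 :=
        Ideal.sum_mem _ fun c _ => by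
          rw [Algebra.smul_def]
          exact Ideal.mul_mem_left _ _ (huA c)
      convert Ideal.add_mem _ h1 h3 using 1
      simp only [sub_smul, Finset.sum_sub_distrib, smul_sub, Matrix.mul_apply, Finset.sum_smul,
        Finset.smul_sum, smul_smul, Matrix.one_apply, ite_smul, one_smul, zero_smul,
        Finset.sum_ite_eq, Finset.mem_univ, if_true]
      rw [Finset.sum_comm]
      ring
    have h3 := congrFun (eq_zero_of_sum_coord_mem h2) b
    exact (sub_eq_zero.1 h3).symm
  -- Modulo `I` the form `P i` in the coordinates is congruent to an element of order `d + 1`, so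
  -- its image `P i (u)` lies in `𝔪 ^ (d + 1) ⊔ I'`. In degree `d` only the linear parts of `u` and
  -- the values at the origin of the coefficients of the `δ' j` survive.
  have key : ∀ i, ∃ B : Fin k → ℂ, ∀ x, MvPolynomial.eval (A.mulVec x) (P i) =
      ∑ j, B j * MvPolynomial.eval x (P' j) := by
    intro i
    have h1 : MvPolynomial.aeval u (P i) ∈ 𝔪 ^ (d + 1) ⊔ I' := by
      refine map_maxIdeal_pow_le (hId.trans hle) e.toAlgHom
        (f := -(δ i - MvPolynomial.aeval coord (P i))) (neg_mem (h i)) ?_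
      have h2 : Ideal.Quotient.mk I (δ i) = 0 :=
        Ideal.Quotient.eq_zero_iff_mem.2 (Ideal.subset_span ⟨i, rfl⟩)
      change Ideal.Quotient.mkₐ ℂ I' _ = _
      rw [neg_sub, map_sub, h2, sub_zero]
      change _ = (e.toAlgHom.comp (Ideal.Quotient.mkₐ ℂ I)) _
      rw [← AlgHom.comp_apply, ← AlgHom.comp_apply, MvPolynomial.comp_aeval,
        MvPolynomial.comp_aeval]
      congr 2
      exact funext hue
    obtain ⟨r, hr, s, hs, hrs⟩ := Submodule.mem_sup.1 h1
    obtain ⟨c, rfl⟩ := Ideal.mem_span_range_iff_exists_fun.1 hs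
    refine ⟨fun j => evalGerm 0 (c j), fun x => ?_⟩
    set Q : MvPolynomial (Fin m) ℂ := MvPolynomial.aeval
      (fun a => ∑ b, MvPolynomial.C (A a b) * MvPolynomial.X b) (P i) -
        ∑ j, MvPolynomial.C (evalGerm 0 (c j)) * P' j with hQ
    have hQh : Q.IsHomogeneous d := by
      refine MvPolynomial.IsHomogeneous.sub ?_ ?_
      · have := (hP i).aeval (fun a => ∑ b, MvPolynomial.C (A a b) * MvPolynomial.X b) (n := 1)
          (fun a => MvPolynomial.IsHomogeneous.sum _ _ _ fun b _ =>
            (MvPolynomial.isHomogeneous_X ℂ b).C_mul _)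
        simpa using this
      · exact MvPolynomial.IsHomogeneous.sum _ _ _ fun j _ => (hP' j).C_mul _
    have hQm : MvPolynomial.aeval coord Q ∈ 𝔪 ^ (d + 1) := by
      have h2 := aeval_sub_aeval_mem (hP i) hu (fun a => sum_coord_mem (A a)) huA
      have h3 : ∑ j, (c j * δ' j - algebraMap ℂ 𝒪 (evalGerm 0 (c j)) *
          MvPolynomial.aeval coord (P' j)) ∈ 𝔪 ^ (d + 1) := by
        refine Ideal.sum_mem _ fun j _ => ?_
        have := mul_sub_mul_mem (𝔞 := 𝔪) (k := 0) (u := c j)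
          (v := algebraMap ℂ 𝒪 (evalGerm 0 (c j))) (l := d) (u' := δ' j)
          (v' := MvPolynomial.aeval coord (P' j)) (by simp) ?_
          (by simpa using sub_algebraMap_evalGerm_mem (c j)) (h' j)
        · rwa [zero_add] at this
        · have := sub_mem (hδ' j) (Ideal.pow_le_pow_right (Nat.le_succ d) (h' j))
          rwa [sub_sub_cancel] at this
      have h4 : MvPolynomial.aeval coord Q = r - (MvPolynomial.aeval u (P i) -
          MvPolynomial.aeval (fun a => ∑ b, A a b • coord b) (P i)) +
          ∑ j, (c j * δ' j - algebraMap ℂ 𝒪 (evalGerm 0 (c j)) *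
          MvPolynomial.aeval coord (P' j)) := by
        rw [← hrs, hQ, map_sub, ← AlgHom.comp_apply, MvPolynomial.comp_aeval, map_sum,
          Finset.sum_sub_distrib]
        simp only [map_mul, map_sum, MvPolynomial.aeval_X, MvPolynomial.aeval_C,
          Algebra.smul_def]
        ring
      rw [h4]
      exact add_mem (sub_mem hr h2) h3
    have h2 := eval_eq_zero_of_aeval_coord_mem hQh hQm x
    rw [hQ, map_sub, sub_eq_zero, ← MvPolynomial.aeval_eq_eval, ← AlgHom.comp_apply,
      MvPolynomial.comp_aeval] at h2
    simp only [map_sum, map_mul, MvPolynomial.aeval_X, MvPolynomial.aeval_C] at h2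
    exact h2
  choose B hB using key
  have hAA' : A * A' = 1 := mul_eq_one_comm.1 hAA
  -- `key` has `A` on the side of `P`; substituting `A' x` for `x` moves it to the other side as
  -- `A'`.
  refine ⟨A', B, IsUnit.of_mul_eq_one _ hAA, fun i x => ?_⟩
  rw [← hB, Matrix.mulVec_mulVec, hAA', Matrix.one_mulVec]

end Isomorphisms

/-! ### Analytic images of smaller dimension, by Hausdorff dimension. -/

section Dimension

/-- Finitely many images of analytic maps from a space of smaller dimension do not cover a
neighbourhood of a point. -/
theorem exists_mem_notMem_range {E F ι : Type*} [NormedAddCommGroup E] [NormedSpace ℂ E]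
    [FiniteDimensional ℂ E] [NormedAddCommGroup F] [NormedSpace ℂ F] [FiniteDimensional ℂ F]
    {S : Set ι} (hS : S.Finite) {Ψ : ι → E → F} (hΨ : ∀ i, AnalyticOnNhd ℂ (Ψ i) Set.univ)
    (hlt : Module.finrank ℂ E < Module.finrank ℂ F) {x : F} {U : Set F} (hU : U ∈ 𝓝 x) :
    ∃ y ∈ U, ∀ i ∈ S, y ∉ Set.range (Ψ i) := by
  by_contra! hcon
  have hsub : U ⊆ ⋃ i ∈ S, Set.range (Ψ i) := fun y hy => by
    obtain ⟨i, hi, h⟩ := hcon y hy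
    exact Set.mem_biUnion hi h
  -- A neighbourhood in `F` has the full real dimension of `F`, and a C¹ image of `E` at most that
  -- of `E`. Both are twice the complex dimension.
  let : NormedSpace ℝ E := NormedSpace.restrictScalars ℝ ℂ E
  let : NormedSpace ℝ F := NormedSpace.restrictScalars ℝ ℂ F
  have : FiniteDimensional ℝ E := FiniteDimensional.complexToReal E
  have : FiniteDimensional ℝ F := FiniteDimensional.complexToReal F
  have h1 := Real.dimH_of_mem_nhds hU
  have h2 : dimH (⋃ i ∈ S, Set.range (Ψ i)) ≤ Module.finrank ℝ E := by
    rw [dimH_bUnion hS.countable]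
    refine iSup₂_le fun i _ => ?_
    have h3 : ContDiff ℂ 1 (Ψ i) := (hΨ i).contDiff
    exact h3.restrict_scalars ℝ |>.dimH_range_le
  have h3 := (h1.symm.le.trans (dimH_mono hsub)).trans h2
  rw [finrank_real_of_complex, finrank_real_of_complex] at h3
  have h4 : 2 * Module.finrank ℂ F ≤ 2 * Module.finrank ℂ E := by exact_mod_cast h3
  omega

end Dimension

/-! ### Consequence of simplicity for families through the origin. -/

section Families

variable {m n : ℕ}

local notation "𝔪" => maxIdeal (0 : Fin m → ℂ)
local notation "𝒪" => LocalRingAt (0 : Fin m → ℂ)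

/-- The linear perturbation of `M` by the matrices `φ b`, with coefficients `t b`. -/
def perturb {β : Type*} [Fintype β] (M : Matrix (Fin (n + 1)) (Fin n) 𝒪)
    (φ : β → Matrix (Fin (n + 1)) (Fin n) 𝒪) (t : β → ℂ) : Matrix (Fin (n + 1)) (Fin n) 𝒪 :=
  Matrix.of fun i j => M i j + ∑ b, t b • φ b i j

theorem minorsIdeal_zero {R : Type*} [CommRing R] (hn : 0 < n) :
    minorsIdeal (0 : Matrix (Fin (n + 1)) (Fin n) R) = ⊥ := by
  rw [minorsIdeal, Ideal.span_eq_bot]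
  rintro _ ⟨i, rfl⟩
  have : Nonempty (Fin n) := ⟨⟨0, hn⟩⟩
  exact Matrix.det_zero

/-- In a family of perturbations of a simple singularity that fixes the origin, finitely many
members represent all the germs at the origin. -/
theorem IsSimpleSingularity.exists_finite {M : Matrix (Fin (n + 1)) (Fin n) 𝒪} (hn : 0 < n)
    (hM : ∀ i j, M i j ∈ 𝔪) (hs : IsSimpleSingularity M) {β : Type*} [Fintype β]
    (φ : β → Matrix (Fin (n + 1)) (Fin n) 𝒪) (hφ : ∀ b i j, φ b i j ∈ 𝔪) :
    ∃ U ∈ 𝓝 (0 : β → ℂ), ∀ V ⊆ U, ∃ S ⊆ V, S.Finite ∧ ∀ t ∈ V, ∃ s ∈ S,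
      Nonempty ((𝒪 ⧸ minorsIdeal (perturb M φ t)) ≃ₐ[ℂ] (𝒪 ⧸ minorsIdeal (perturb M φ s))) := by
  let e := Fintype.equivFin β
  let F : (Fin (Fintype.card β) → ℂ) → (Fin m → ℂ) → Matrix (Fin (n + 1)) (Fin n) ℂ :=
    fun t x => Matrix.of fun i j => repr (M i j) x + ∑ b, t (e b) * repr (φ b i j) x
  have hgerm : ∀ t, germMatrix 0 (F t) = perturb M φ fun b => t (e b) := by
    intro t
    ext i j
    have h1 : ∀ b, AnalyticAt ℂ (fun x => t (e b) * repr (φ b i j) x) 0 := fun b =>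
      analyticAt_const.mul (analyticAt_repr _)
    change germ 0 (fun x => repr (M i j) x + ∑ b, t (e b) * repr (φ b i j) x) = _
    rw [germ_add (analyticAt_repr _) (Finset.analyticAt_fun_sum _ fun b _ => h1 b), germ_repr,
      germ_sum _ h1]
    simp only [germ_mul analyticAt_const (analyticAt_repr _), germ_repr, germ_const, perturb,
      Matrix.of_apply, Algebra.smul_def]
  have hdef : IsDeformation M F := by
    refine ⟨fun i j => ?_, ?_⟩
    · have hr : ∀ g : 𝒪, AnalyticAt ℂ
          (fun z : (Fin (Fintype.card β) → ℂ) × (Fin m → ℂ) => repr g z.2) 0 := fun g =>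
        AnalyticAt.fun_comp (g := repr g) (analyticAt_repr g) analyticAt_snd
      refine (hr _).add (Finset.analyticAt_fun_sum _ fun b _ => AnalyticAt.mul ?_ (hr _))
      exact AnalyticAt.fun_comp (g := fun t : Fin (Fintype.card β) → ℂ => t (e b))
        (analyticAt_coord _ _) analyticAt_fst
    · rw [hgerm]
      ext i j
      simp [perturb]
  obtain ⟨S, hS, hev⟩ := hs _ F hdef
  -- All matrices of the family vanish at `x = 0`, so the origin lies on every fibre and the
  -- parameters alone can be varied.
  let ι : (β → ℂ) → (Fin (Fintype.card β) → ℂ) × (Fin m → ℂ) := fun t => (fun k => t (e.symm k), 0)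
  have hι : Filter.Tendsto ι (𝓝 0) (𝓝 0) := by
    have : Continuous ι := by fun_prop
    exact this.tendsto 0
  have hmem : ∀ t, MemFibre F (ι t) := by
    intro t
    have : F (ι t).1 (ι t).2 = 0 := by
      ext i j
      have h0 : ∀ g : 𝒪, g ∈ 𝔪 → repr g 0 = 0 := fun g hg => by
        rw [← evalGerm_germ (analyticAt_repr g), germ_repr]
        exact mem_maxIdeal.1 hg
      simp [F, ι, h0 _ (hM _ _), h0 _ (hφ _ _ _)]
    rw [MemFibre, this, minorsIdeal_zero hn]
  have hring : ∀ t, minorsIdeal (germMatrix (ι t).2 (F (ι t).1)) =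
      minorsIdeal (perturb M φ t) := by
    intro t
    change minorsIdeal (germMatrix 0 _) = _
    rw [hgerm]
    simp [ι]
  refine ⟨_, hι.eventually hev, fun V hV => ?_⟩
  choose! c hcS hc using fun t (ht : t ∈ V) => hV ht (hmem t)
  -- The representatives in `S` may be arbitrary points of the total space. They are replaced by one
  -- parameter in `V` for each class that occurs over `V`, so that representatives inherit whatever
  -- generality defines `V`.
  obtain ⟨S', hS'V, hbij⟩ := Set.exists_subset_bijOn V c
  refine ⟨S', hS'V, ?_, fun t ht => ?_⟩
  · rw [hbij.finite_iff_finite]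
    exact hS.subset (Set.image_subset_iff.2 hcS)
  · obtain ⟨s, hs', hst⟩ := hbij.surjOn (Set.mem_image_of_mem c ht)
    obtain ⟨e1⟩ := hc t ht
    obtain ⟨e2⟩ := hc s (hS'V hs')
    rw [hst] at e2
    refine ⟨s, hs', ⟨?_⟩⟩
    rw [← hring t, ← hring s]
    exact e1.trans e2.symm

end Families

/-! ### The case `n = 1`: pencils of quadrics. -/

section Quadrics

variable {m : ℕ}

local notation "𝔪" => maxIdeal (0 : Fin m → ℂ)
local notation "𝒪" => LocalRingAt (0 : Fin m → ℂ)

theorem exists_sub_aeval_coord_mem {g : 𝒪} (hg : g ∈ 𝔪 ^ 2) :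
    ∃ μ : MvPolynomial (Fin m) ℂ, μ.IsHomogeneous 2 ∧
      g - MvPolynomial.aeval coord μ ∈ 𝔪 ^ 3 := by
  rw [pow_two] at hg
  refine Submodule.mul_induction_on hg (fun u hu v hv => ?_) fun u v hu hv => ?_
  · obtain ⟨c, hc⟩ := exists_sub_sum_coord_mem hu
    obtain ⟨d, hd⟩ := exists_sub_sum_coord_mem hv
    have hlin : ∀ c : Fin m → ℂ,
        (∑ a, MvPolynomial.C (c a) * MvPolynomial.X a : MvPolynomial (Fin m) ℂ).IsHomogeneous 1 :=
      fun c => MvPolynomial.IsHomogeneous.sum _ _ _ fun a _ =>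
        (MvPolynomial.isHomogeneous_X ℂ a).C_mul _
    refine ⟨_, (hlin c).mul (hlin d), ?_⟩
    have := mul_sub_mul_mem (𝔞 := 𝔪) (k := 1) (l := 1) (by simpa using hu)
      (by simpa using sum_coord_mem d) hc hd
    simpa [Algebra.smul_def] using this
  · obtain ⟨μ, h1, h2⟩ := hu
    obtain ⟨ν, h3, h4⟩ := hv
    refine ⟨μ + ν, h1.add h3, ?_⟩
    rw [map_add, add_sub_add_comm]
    exact add_mem h2 h4

/-- The coefficient of `x_a x_b` in a quadratic form. -/
def quadCoeff (a b : Fin m) (q : (Fin m → ℂ) → ℂ) : ℂ :=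
  if a = b then q (Pi.single a 1) else
    q (Pi.single a 1 + Pi.single b 1) - q (Pi.single a 1) - q (Pi.single b 1)

/-- Pairs of indices of the quadratic monomials. -/
abbrev QuadIndex (m : ℕ) : Type := {ab : Fin m × Fin m // ab.1 ≤ ab.2}

theorem quadCoeff_sum (t : QuadIndex m → ℂ) (c : QuadIndex m) :
    quadCoeff c.1.1 c.1.2 (fun x => ∑ b : QuadIndex m, t b * (x b.1.1 * x b.1.2)) = t c := by
  obtain ⟨⟨a, b⟩, hab⟩ := c
  simp only [quadCoeff]
  split_ifs with h
  · rw [Finset.sum_eq_single ⟨(a, b), hab⟩]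
    · simp [h]
    · rintro ⟨⟨c, d⟩, hcd⟩ - hne
      have : ¬(c = a ∧ d = a) := by
        rintro ⟨rfl, rfl⟩
        exact hne (by simp [h])
      simp only [Pi.single_apply]
      split_ifs <;> simp_all
    · simp
  · rw [← Finset.sum_sub_distrib, ← Finset.sum_sub_distrib, Finset.sum_eq_single ⟨(a, b), hab⟩]
    · simp [h, Ne.symm h]
    · rintro ⟨⟨c, d⟩, hcd⟩ - hne
      have h1 : ¬(c = a ∧ d = b) := by
        rintro ⟨rfl, rfl⟩
        exact hne rfl
      have h2 : ¬(c = b ∧ d = a) := by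
        rintro ⟨rfl, rfl⟩
        exact h (le_antisymm hab hcd)
      simp only [Pi.single_apply, Pi.add_apply]
      split_ifs <;> simp_all
    · simp

theorem two_mul_card_quadIndex : 2 * Fintype.card (QuadIndex m) = m * (m + 1) := by
  rw [← Fintype.card_congr (Sym2.sortEquiv (α := Fin m)), Sym2.card, Fintype.card_fin,
    Nat.choose_two_right, Nat.add_sub_cancel, mul_comm (m + 1),
    Nat.mul_div_cancel' (Nat.even_mul_succ_self m).two_dvd]

/-- All quadratic terms of the two equations are perturbed independently, and the resulting pairs of
quadratic forms are counted up to linear equivalence. -/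
theorem not_isSimpleSingularity_of_pencil (hm : 5 ≤ m) {M : Matrix (Fin 2) (Fin 1) 𝒪}
    (hM : ∀ i, M i 0 ∈ 𝔪 ^ 2) : ¬IsSimpleSingularity M := by
  intro hs
  have hle : 𝔪 ^ 2 ≤ 𝔪 := Ideal.pow_le_self two_ne_zero
  let φ : Fin 2 × QuadIndex m → Matrix (Fin 2) (Fin 1) 𝒪 := fun b =>
    Matrix.of fun i _ => if i = b.1 then coord b.2.1.1 * coord b.2.1.2 else 0
  have hcoord : ∀ b : QuadIndex m, coord b.1.1 * coord b.1.2 ∈ 𝔪 ^ 2 := fun b => by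
    rw [pow_two]
    exact Ideal.mul_mem_mul (coord_mem _) (coord_mem _)
  have hφ : ∀ b i j, φ b i j ∈ 𝔪 := by
    intro b i j
    simp only [φ, Matrix.of_apply]
    split_ifs
    · exact hle (hcoord _)
    · exact zero_mem _
  have hM' : ∀ i j, M i j ∈ 𝔪 := fun i j => by
    rw [Subsingleton.elim j 0]
    exact hle (hM i)
  obtain ⟨U, hU, hfin⟩ := hs.exists_finite one_pos hM' φ hφ
  obtain ⟨S, -, hSf, hS⟩ := hfin U subset_rfl
  choose μ hμ hμM using fun i => exists_sub_aeval_coord_mem (hM i)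
  let P : (Fin 2 × QuadIndex m → ℂ) → Fin 2 → MvPolynomial (Fin m) ℂ := fun t i =>
    μ i + ∑ b : QuadIndex m, MvPolynomial.C (t (i, b)) *
      (MvPolynomial.X b.1.1 * MvPolynomial.X b.1.2)
  have hP : ∀ t i, (P t i).IsHomogeneous 2 := fun t i =>
    (hμ i).add (MvPolynomial.IsHomogeneous.sum _ _ _ fun b _ =>
      ((MvPolynomial.isHomogeneous_X ℂ _).mul (MvPolynomial.isHomogeneous_X ℂ _)).C_mul _)
  have hentry : ∀ t i, perturb M φ t i 0 =
      M i 0 + ∑ b : QuadIndex m, t (i, b) • (coord b.1.1 * coord b.1.2) := by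
    intro t i
    simp only [perturb, Matrix.of_apply, φ, Fintype.sum_prod_type]
    rw [Finset.sum_eq_single i]
    · simp
    · intro k _ hk
      simp [hk.symm]
    · simp
  have hcong : ∀ t i, perturb M φ t i 0 - MvPolynomial.aeval coord (P t i) ∈ 𝔪 ^ (2 + 1) := by
    intro t i
    rw [hentry]
    simpa [P, Algebra.smul_def] using hμM i
  have hideal : ∀ t, minorsIdeal (perturb M φ t) =
      Ideal.span (Set.range fun i => perturb M φ t i 0) := by
    intro t
    rw [minorsIdeal]
    simp only [Matrix.det_unique, Matrix.submatrix_apply]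
    congr 1
    ext g
    -- Deleting row 0 leaves entry 1 and conversely, so the minors are the two entries in exchanged
    -- order.
    exact Fin.exists_fin_two.trans (or_comm.trans
      (Fin.exists_fin_two (p := fun i => perturb M φ t i 0 = g)).symm)
  have hmem : ∀ t i, perturb M φ t i 0 ∈ 𝔪 ^ 2 := by
    intro t i
    rw [hentry]
    refine add_mem (hM i) (Ideal.sum_mem _ fun b _ => ?_)
    rw [Algebra.smul_def]
    exact Ideal.mul_mem_left _ _ (hcoord b)
  -- `Ψ s` sends a pair `(A, B)` to the only parameter `t` for which `P t` could be the transform of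
  -- `P s` by `A` and `B`.
  let Ψ : (Fin 2 × QuadIndex m → ℂ) → ((Fin m × Fin m) ⊕ (Fin 2 × Fin 2) → ℂ) →
      (Fin 2 × QuadIndex m → ℂ) := fun s y c =>
    quadCoeff c.2.1.1 c.2.1.2 (fun x => ∑ j, y (Sum.inr (c.1, j)) * MvPolynomial.eval
      ((Matrix.of fun a b => y (Sum.inl (a, b))).mulVec x) (P s j) - MvPolynomial.eval x (μ c.1))
  have hΨ : ∀ s, AnalyticOnNhd ℂ (Ψ s) Set.univ := by
    intro s y _
    have hy : ∀ c, AnalyticAt ℂ (fun y : (Fin m × Fin m) ⊕ (Fin 2 × Fin 2) → ℂ => y c) y :=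
      fun c => (ContinuousLinearMap.proj (R := ℂ)
        (φ := fun _ : (Fin m × Fin m) ⊕ (Fin 2 × Fin 2) => ℂ) c).analyticAt y
    rw [analyticAt_pi_iff]
    intro c
    have h1 : ∀ x, AnalyticAt ℂ (fun y : (Fin m × Fin m) ⊕ (Fin 2 × Fin 2) → ℂ =>
        ∑ j, y (Sum.inr (c.1, j)) * MvPolynomial.eval
          ((Matrix.of fun a b => y (Sum.inl (a, b))).mulVec x) (P s j) -
            MvPolynomial.eval x (μ c.1)) y := fun x => by
      refine AnalyticAt.sub (Finset.analyticAt_fun_sum _ fun j _ => (hy _).mul ?_) analyticAt_const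
      refine AnalyticAt.aeval_mvPolynomial (fun a => ?_) (P s j)
      simp only [Matrix.mulVec, dotProduct, Matrix.of_apply]
      exact Finset.analyticAt_fun_sum _ fun b _ => (hy (Sum.inl (a, b))).mul analyticAt_const
    simp only [quadCoeff]
    split_ifs
    · exact h1 _
    · exact ((h1 _).sub (h1 _)).sub (h1 _)
  -- The inequality is `m² + 4 < m(m+1)`, true because `m ≥ 5`.
  obtain ⟨t, htU, ht⟩ := exists_mem_notMem_range hSf hΨ (by
    rw [Module.finrank_fintype_fun_eq_card, Module.finrank_fintype_fun_eq_card]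
    simp only [Fintype.card_sum, Fintype.card_prod, Fintype.card_fin, two_mul_card_quadIndex]
    nlinarith) hU
  obtain ⟨s, hsS, ⟨e⟩⟩ := hS t htU
  rw [hideal, hideal] at e
  obtain ⟨A, B, -, hAB⟩ := exists_linear_of_algEquiv le_rfl (hP t) (hP s) (hmem t) (hmem s)
    (hcong t) (hcong s) e
  refine ht s hsS ⟨Sum.elim (fun ab => A ab.1 ab.2) (fun ij => B ij.1 ij.2), ?_⟩
  ext ⟨i, c⟩
  rw [← quadCoeff_sum (fun b => t (i, b)) c]
  simp only [Ψ, Sum.elim_inr, Sum.elim_inl]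
  congr 1
  ext x
  have h1 : (Matrix.of fun a b => A a b) = A := rfl
  rw [h1, ← hAB]
  simp [P]

end Quadrics

/-! ### Signed maximal minors and their syzygies. -/

section SignedMinors

variable {R : Type*} [CommRing R] {n : ℕ}

/-- The maximal minors of an `(n+1) × n` matrix, with alternating signs. -/
def signedMinor (L : Matrix (Fin (n + 1)) (Fin n) R) (i : Fin (n + 1)) : R :=
  (-1) ^ (i : ℕ) * (L.submatrix i.succAbove id).det

/-- This is the expansion along the first column of the square matrix obtained by prepending a
second copy of column `j`. -/
theorem sum_signedMinor_mul (L : Matrix (Fin (n + 1)) (Fin n) R) (j : Fin n) :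
    ∑ i, signedMinor L i * L i j = 0 := by
  have h := Matrix.det_succ_column
    (Matrix.of fun i => (Fin.cons (L i j) (L i) : Fin (n + 1) → R)) 0
  rw [Matrix.det_zero_of_column_eq (i := 0) (j := j.succ) (Fin.succ_ne_zero j).symm
    (fun i => by simp)] at h
  rw [h]
  refine Finset.sum_congr rfl fun i _ => ?_
  have h1 : (Matrix.of fun i => (Fin.cons (L i j) (L i) : Fin (n + 1) → R)).submatrix
      i.succAbove (Fin.succAbove 0) = L.submatrix i.succAbove id := by
    ext a b
    simp
  rw [h1]
  simp [signedMinor]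
  ring

theorem signedMinor_eq_zero_of_mulVec_eq_zero {K : Type*} [Field K]
    {L : Matrix (Fin (n + 1)) (Fin n) K} {c : Fin n → K} (hc : c ≠ 0) (h : L.mulVec c = 0)
    (i : Fin (n + 1)) : signedMinor L i = 0 := by
  have : (L.submatrix i.succAbove id).det = 0 :=
    Matrix.exists_mulVec_eq_zero_iff.1 ⟨c, hc, funext fun k => congrFun h (i.succAbove k)⟩
  rw [signedMinor, this, mul_zero]

end SignedMinors

/-! ### Rank of a space of functions, tested at finitely many points. -/

section LinearAlgebra

/-- Linearly independent functions are separated by as many points. -/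
theorem exists_det_ne_zero {X V : Type*} [AddCommGroup V] [Module ℂ V] [FiniteDimensional ℂ V]
    (f : V →ₗ[ℂ] (X → ℂ)) {r : ℕ} (hr : r ≤ Module.finrank ℂ (LinearMap.range f)) :
    ∃ (q : Fin r → V) (x : Fin r → X), (Matrix.of fun i j => f (q j) (x i)).det ≠ 0 := by
  obtain ⟨g, hg⟩ := exists_linearIndependent_of_le_finrank hr
  choose q hq using fun j => (g j).2
  have hgq : LinearIndependent ℂ fun j => f (q j) := by
    have := hg.map' (LinearMap.range f).subtype (Submodule.ker_subtype _)
    rwa [show (fun j => f (q j)) = (LinearMap.range f).subtype ∘ g from funext hq]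
  -- A nonzero functional that kills all vectors of values would be a linear relation between the
  -- functions `f (q j)`. So some `r` points give a basis.
  have hspan : Submodule.span ℂ (Set.range fun x : X => fun j => f (q j) x) = ⊤ := by
    by_contra hne
    obtain ⟨ℓ, hℓ, hker⟩ := Submodule.exists_le_ker_of_lt_top _ (lt_top_iff_ne_top.2 hne)
    apply hℓ
    have h1 : ∀ v, ℓ v = ∑ j, v j * ℓ (Pi.single j 1) := fun v => by
      conv_lhs => rw [← Finset.univ_sum_single v, map_sum]
      refine Finset.sum_congr rfl fun j _ => ?_
      rw [← smul_eq_mul, ← map_smul, ← Pi.single_smul, smul_eq_mul, mul_one]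
    have h2 : ∑ j, ℓ (Pi.single j 1) • f (q j) = 0 := by
      ext x
      have := hker (Submodule.subset_span ⟨x, rfl⟩)
      rw [LinearMap.mem_ker, h1] at this
      simpa [Finset.sum_apply, mul_comm] using this
    have h3 := Fintype.linearIndependent_iff.1 hgq _ h2
    ext j
    simpa using h3 j
  obtain ⟨κ, a, -, hsp, hli⟩ := exists_linearIndependent' ℂ fun x : X => fun j => f (q j) x
  rw [hspan] at hsp
  let e := (Module.Basis.mk hli hsp.ge).indexEquiv (Pi.basisFun ℂ (Fin r))
  refine ⟨q, a ∘ e.symm, ?_⟩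
  have h1 := Matrix.linearIndependent_rows_iff_isUnit.1 (hli.comp e.symm e.symm.injective)
  exact ((Matrix.isUnit_iff_isUnit_det _).1 h1).ne_zero

theorem finrank_ker_le_of_det_ne_zero {X V : Type*} [AddCommGroup V] [Module ℂ V]
    [FiniteDimensional ℂ V] (f : V →ₗ[ℂ] (X → ℂ)) {r k : ℕ} (hr : Module.finrank ℂ V ≤ r + k)
    {q : Fin r → V} {x : Fin r → X} (h : (Matrix.of fun i j => f (q j) (x i)).det ≠ 0) :
    Module.finrank ℂ (LinearMap.ker f) ≤ k := by
  have h1 := f.finrank_range_add_finrank_ker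
  have h2 : LinearIndependent ℂ fun j => f (q j) := by
    rw [Fintype.linearIndependent_iff]
    intro c hc
    have := Matrix.eq_zero_of_mulVec_eq_zero h (v := c) (by
      ext i
      simpa [Matrix.mulVec, dotProduct, Finset.sum_apply, mul_comm] using congrFun hc (x i))
    exact fun i => congrFun this i
  have h3 : LinearIndependent ℂ fun j => (⟨f (q j), q j, rfl⟩ : LinearMap.range f) :=
    LinearIndependent.of_comp (LinearMap.range f).subtype h2
  have h4 := h3.fintype_card_le_finrank
  rw [Fintype.card_fin] at h4
  omega

end LinearAlgebra

/-! ### Linear matrices recovered from their maximal minors. -/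

section LinearMatrices

variable {m n : ℕ}

/-- The coefficients of an `(n+1) × n` matrix of linear forms in `m` variables. -/
abbrev LinCoeff (m n : ℕ) : Type := Fin (n + 1) × Fin n × Fin m → ℂ

/-- The value at `x` of the matrix of linear forms with coefficients `T`. -/
def linValue (T : LinCoeff m n) (x : Fin m → ℂ) : Matrix (Fin (n + 1)) (Fin n) ℂ :=
  Matrix.of fun i j => ∑ a, T (i, j, a) * x a

/-- The pairing of vectors of polynomials of degree at most one with the signed minors of a matrix
of linear forms. Its kernel consists of the syzygies of degree at most one. -/
def syzygyMap (T : LinCoeff m n) :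
    (Fin (n + 1) → Option (Fin m) → ℂ) →ₗ[ℂ] ((Fin m → ℂ) → ℂ) where
  toFun N x := ∑ i, signedMinor (linValue T x) i * (N i none + ∑ a, N i (some a) * x a)
  map_add' N N' := by
    ext x
    simp only [Pi.add_apply, ← Finset.sum_add_distrib, add_mul]
    refine Finset.sum_congr rfl fun i _ => ?_
    rw [Finset.sum_add_distrib]
    ring
  map_smul' c N := by
    ext x
    simp only [Pi.smul_apply, smul_eq_mul, RingHom.id_apply, mul_assoc, ← Finset.mul_sum]
    rw [Finset.mul_sum]
    exact Finset.sum_congr rfl fun i _ => by ring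

/-- The columns of a matrix of linear forms, as syzygies of its signed minors. -/
def columnMap (T : LinCoeff m n) :
    (Fin n → ℂ) →ₗ[ℂ] (Fin (n + 1) → Option (Fin m) → ℂ) where
  toFun c i a := a.elim 0 fun a => ∑ j, T (i, j, a) * c j
  map_add' c d := by
    ext i (_ | a) <;> simp [mul_add, Finset.sum_add_distrib]
  map_smul' r c := by
    ext i (_ | a) <;> simp [Finset.mul_sum, mul_left_comm]

/-- The minors of `T` have no more syzygies of degree at most one than the columns of `T` give. -/
def IsGeneral (T : LinCoeff m n) : Prop :=
  Module.finrank ℂ (LinearMap.ker (syzygyMap T)) ≤ n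

theorem linValue_mulVec (T : LinCoeff m n) (c : Fin n → ℂ) (x : Fin m → ℂ) (i : Fin (n + 1)) :
    (linValue T x).mulVec c i = ∑ a, columnMap T c i (some a) * x a := by
  simp only [Matrix.mulVec, dotProduct, linValue, Matrix.of_apply, columnMap, LinearMap.coe_mk,
    AddHom.coe_mk, Option.elim_some, Finset.sum_mul]
  rw [Finset.sum_comm]
  refine Finset.sum_congr rfl fun a _ => Finset.sum_congr rfl fun j _ => by ring

theorem range_columnMap_le (T : LinCoeff m n) :
    LinearMap.range (columnMap T) ≤ LinearMap.ker (syzygyMap T) := by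
  rintro _ ⟨c, rfl⟩
  rw [LinearMap.mem_ker]
  ext x
  have h1 : ∀ i, columnMap T c i none = 0 := fun i => rfl
  simp only [syzygyMap, LinearMap.coe_mk, AddHom.coe_mk, h1, zero_add, ← linValue_mulVec,
    Matrix.mulVec, dotProduct, Finset.mul_sum, Pi.zero_apply]
  rw [Finset.sum_comm]
  simp only [← mul_assoc, ← Finset.sum_mul, sum_signedMinor_mul, zero_mul, Finset.sum_const_zero]

/-- A relation between the columns would make all minors vanish; then everything is a syzygy, which
gives dimension `(n+1)(m+1) > n`. So the columns span a space of dimension `n` inside a kernel of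
dimension at most `n`. -/
theorem IsGeneral.range_columnMap {T : LinCoeff m n} (hT : IsGeneral T) :
    LinearMap.range (columnMap T) = LinearMap.ker (syzygyMap T) := by
  have hinj : Function.Injective (columnMap T) := by
    rw [injective_iff_map_eq_zero]
    intro c hc
    by_contra hne
    have h1 : syzygyMap T = 0 := by
      refine LinearMap.ext fun N => funext fun x => ?_
      have h2 : (linValue T x).mulVec c = 0 := by
        ext i
        rw [linValue_mulVec, hc]
        simp
      simp [syzygyMap, signedMinor_eq_zero_of_mulVec_eq_zero hne h2]
    rw [IsGeneral, h1, LinearMap.ker_zero, finrank_top, Module.finrank_pi_fintype] at hT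
    simp only [Module.finrank_fintype_fun_eq_card, Fintype.card_option, Fintype.card_fin,
      Finset.sum_const, Finset.card_univ, smul_eq_mul] at hT
    nlinarith
  refine Submodule.eq_of_le_of_finrank_le (range_columnMap_le T) ?_
  rw [LinearMap.finrank_range_of_inj hinj, Module.finrank_fintype_fun_eq_card, Fintype.card_fin]
  exact hT

/-- The minors of a general matrix of linear forms determine it up to multiplication by
constant matrices. -/
theorem IsGeneral.exists_eq {S T : LinCoeff m n} (hS : IsGeneral S) (hT : IsGeneral T)
    {A : Matrix (Fin m) (Fin m) ℂ} (hA : IsUnit A) {B : Matrix (Fin (n + 1)) (Fin (n + 1)) ℂ}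
    (h : ∀ i x, signedMinor (linValue T x) i =
      ∑ k, B i k * signedMinor (linValue S (A.mulVec x)) k) :
    ∃ (D : Matrix (Fin (n + 1)) (Fin (n + 1)) ℂ) (C : Matrix (Fin n) (Fin n) ℂ),
      ∀ x, linValue T x = D * linValue S (A.mulVec x) * C := by
  -- A row vector that kills `B` would be a nonzero constant syzygy of the minors of `T`, whereas
  -- the columns of `T` have no constant terms.
  have hB : B.det ≠ 0 := by
    intro h0
    obtain ⟨c, hc, hcB⟩ := Matrix.exists_vecMul_eq_zero_iff.2 h0
    let N : Fin (n + 1) → Option (Fin m) → ℂ := fun i a => a.elim (c i) fun _ => 0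
    have hN : N ∈ LinearMap.ker (syzygyMap T) := by
      rw [LinearMap.mem_ker]
      ext x
      simp only [syzygyMap, LinearMap.coe_mk, AddHom.coe_mk, N, Option.elim_none,
        Option.elim_some, zero_mul, Finset.sum_const_zero, add_zero, h, Finset.sum_mul,
        Pi.zero_apply]
      rw [Finset.sum_comm]
      refine Finset.sum_eq_zero fun k _ => ?_
      have := congrFun hcB k
      simp only [Matrix.vecMul, dotProduct, Pi.zero_apply] at this
      calc _ = (∑ i, c i * B i k) * signedMinor (linValue S (A.mulVec x)) k := by
            rw [Finset.sum_mul]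
            exact Finset.sum_congr rfl fun i _ => by ring
        _ = 0 := by rw [this, zero_mul]
    rw [← hT.range_columnMap] at hN
    obtain ⟨d, hd⟩ := hN
    refine hc (funext fun i => ?_)
    exact (congrFun (congrFun hd i) none).symm
  obtain ⟨A', hA'⟩ := hA.exists_left_inv
  have hAA : A * A' = 1 := mul_eq_one_comm.1 hA'
  -- The columns of `Bᵀ T(A⁻¹ y)` are linear syzygies of the minors of `S`, hence combinations of
  -- the columns of `S`. The coefficients form the matrix `C`.
  have key : ∀ j, ∃ c : Fin n → ℂ, ∀ y, (linValue S y).mulVec c =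
      fun k => ∑ i, B i k * linValue T (A'.mulVec y) i j := by
    intro j
    let N : Fin (n + 1) → Option (Fin m) → ℂ := fun k a => a.elim 0 fun a =>
      ∑ i, B i k * linValue T (A'.mulVec (Pi.single a 1)) i j
    have hlin : ∀ k y, ∑ a, N k (some a) * y a = ∑ i, B i k * linValue T (A'.mulVec y) i j := by
      intro k y
      simp only [N, Option.elim_some, linValue, Matrix.of_apply, Matrix.mulVec_single_one,
        Matrix.col_apply, Finset.sum_mul, Finset.mul_sum]
      simp only [Matrix.mulVec, dotProduct, Finset.mul_sum]
      rw [Finset.sum_comm]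
      refine Finset.sum_congr rfl fun i _ => ?_
      rw [Finset.sum_comm]
      refine Finset.sum_congr rfl fun b _ => Finset.sum_congr rfl fun a _ => by ring
    have hN : N ∈ LinearMap.ker (syzygyMap S) := by
      rw [LinearMap.mem_ker]
      ext y
      simp only [syzygyMap, LinearMap.coe_mk, AddHom.coe_mk, hlin, Pi.zero_apply]
      have h1 := sum_signedMinor_mul (linValue T (A'.mulVec y)) j
      simp only [h, Matrix.mulVec_mulVec, hAA, Matrix.one_mulVec, Finset.sum_mul] at h1
      rw [Finset.sum_comm] at h1
      rw [← h1]
      refine Finset.sum_congr rfl fun k _ => ?_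
      simp only [N, Option.elim_none, zero_add, Finset.mul_sum]
      exact Finset.sum_congr rfl fun i _ => by ring
    rw [← hS.range_columnMap] at hN
    obtain ⟨c, hc⟩ := hN
    refine ⟨c, fun y => funext fun k => ?_⟩
    rw [linValue_mulVec, hc, hlin]
  choose C hC using key
  refine ⟨B.transpose⁻¹, Matrix.of fun l j => C j l, fun x => ?_⟩
  have h1 : B.transpose * linValue T x =
      linValue S (A.mulVec x) * Matrix.of fun l j => C j l := by
    ext k j
    have := congrFun (hC j (A.mulVec x)) k
    rw [Matrix.mulVec_mulVec, hA', Matrix.one_mulVec] at this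
    exact this.symm
  have hu : IsUnit B.transpose.det := by
    rw [Matrix.det_transpose]
    exact isUnit_iff_ne_zero.2 hB
  rw [Matrix.mul_assoc, ← h1, ← Matrix.mul_assoc, Matrix.nonsing_inv_mul _ hu, Matrix.one_mul]

end LinearMatrices

/-! ### General matrices are open and dense: an example and the identity theorem. -/

section GeneralLinearMatrices

variable {m n : ℕ}

/-- A bidiagonal matrix of linear forms, whose maximal minors are, up to sign, the monomials of
degree `n` in two variables. -/
def bidiagonal (n : ℕ) (a b : Fin m) : LinCoeff m n := fun c =>
  if c.2.2 = b ∧ c.1 = c.2.1.castSucc then 1 else if c.2.2 = a ∧ c.1 = c.2.1.succ then -1 else 0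

theorem linValue_bidiagonal {a b : Fin m} (hab : a ≠ b) (x : Fin m → ℂ) (i : Fin (n + 1))
    (j : Fin n) : linValue (bidiagonal n a b) x i j =
      if i = j.castSucc then x b else if i = j.succ then -x a else 0 := by
  have hne : j.castSucc ≠ j.succ := Fin.castSucc_lt_succ.ne
  simp only [linValue, Matrix.of_apply, bidiagonal]
  split_ifs with h1 h2
  · rw [Finset.sum_eq_single b] <;> simp_all
  · rw [Finset.sum_eq_single a] <;> simp_all
  · simp_all

/-- Minor 0 is triangular with diagonal entries `-x a`, and column `j` is the relation `x b * minor
j = x a * minor (j + 1)`. The factor `x a ^ i` avoids division. -/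
theorem pow_mul_signedMinor_bidiagonal {a b : Fin m} (hab : a ≠ b) (x : Fin m → ℂ)
    (i : Fin (n + 1)) : x a ^ (i : ℕ) * signedMinor (linValue (bidiagonal n a b) x) i =
      x b ^ (i : ℕ) * (-x a) ^ n := by
  induction i using Fin.induction with
  | zero =>
    have h : ((linValue (bidiagonal n a b) x).submatrix (Fin.succAbove 0) id).BlockTriangular
        id := by
      intro k j hkj
      change j < k at hkj
      simp only [Matrix.submatrix_apply, Fin.zero_succAbove, id, linValue_bidiagonal hab]
      rw [if_neg, if_neg]
      · intro h
        exact hkj.ne' (Fin.succ_injective _ h)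
      · intro h
        have := congrArg Fin.val h
        simp only [Fin.val_succ, Fin.val_castSucc] at this
        have h2 : (j : ℕ) < k := hkj
        omega
    rw [signedMinor, Matrix.det_of_isUpperTriangular h]
    have h2 : ∀ k : Fin n, k.succ ≠ k.castSucc := fun k => Fin.castSucc_lt_succ.ne'
    simp [linValue_bidiagonal hab, h2]
  | succ j ih =>
    have h1 := sum_signedMinor_mul (linValue (bidiagonal n a b) x) j
    have hne : j.castSucc ≠ j.succ := Fin.castSucc_lt_succ.ne
    rw [Finset.sum_eq_add_of_mem j.castSucc j.succ (Finset.mem_univ _) (Finset.mem_univ _)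
      hne] at h1
    · simp only [linValue_bidiagonal hab, if_true, if_neg hne.symm] at h1
      rw [Fin.val_castSucc] at ih
      rw [Fin.val_succ, pow_succ, pow_succ]
      linear_combination x b * ih - x a ^ (j : ℕ) * h1
    · rintro k - ⟨h2, h3⟩
      rw [linValue_bidiagonal hab, if_neg h2, if_neg h3, mul_zero]

theorem eq_zero_of_forall_sum_pow_mul_eq_zero {k : ℕ} {c : Fin k → ℂ}
    (h : ∀ y : ℂ, ∑ i : Fin k, y ^ (i : ℕ) * c i = 0) : c = 0 :=
  Matrix.eq_zero_of_forall_index_sum_pow_mul_eq_zero (f := fun j : Fin k => ((j : ℕ) : ℂ))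
    (fun _ _ hij => Fin.ext (Nat.cast_injective hij)) fun _ => h _

/-- With `y = x b / x a` the minors are proportional to the powers `y ^ i`, so a syzygy is an
identity between polynomials in `y`. It leaves free only the coefficients of `x b` in the first `n`
components. -/
theorem isGeneral_bidiagonal {a b : Fin m} (hab : a ≠ b) : IsGeneral (bidiagonal n a b) := by
  let f : LinearMap.ker (syzygyMap (bidiagonal n a b)) →ₗ[ℂ] (Fin n → ℂ) :=
    { toFun := fun N i => N.1 i.castSucc (some b)
      map_add' := fun _ _ => rfl
      map_smul' := fun _ _ => rfl }
  have hf : Function.Injective f := by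
    rw [injective_iff_map_eq_zero]
    rintro ⟨N, hN⟩ hfN
    rw [LinearMap.mem_ker] at hN
    have hval : ∀ x : Fin m → ℂ, x a ≠ 0 → ∀ y, x b = y * x a →
        ∑ i : Fin (n + 1), y ^ (i : ℕ) * (N i none + ∑ c, N i (some c) * x c) = 0 := by
      intro x hx y hy
      have h1 := congrFun hN x
      simp only [syzygyMap, LinearMap.coe_mk, AddHom.coe_mk, Pi.zero_apply] at h1
      have h2 : ∀ i : Fin (n + 1), signedMinor (linValue (bidiagonal n a b) x) i =
          (-x a) ^ n * y ^ (i : ℕ) := fun i => by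
        have := pow_mul_signedMinor_bidiagonal (n := n) hab x i
        rw [hy, mul_pow] at this
        refine mul_left_cancel₀ (pow_ne_zero (i : ℕ) hx) ?_
        rw [this]
        ring
      simp only [h2, mul_assoc, ← Finset.mul_sum] at h1
      exact (mul_eq_zero.1 h1).resolve_left (pow_ne_zero _ (neg_ne_zero.2 hx))
    -- Doubling `x` preserves `y` and separates the constant part of the syzygy from its linear
    -- part.
    have hsplit : ∀ x : Fin m → ℂ, x a ≠ 0 → ∀ y, x b = y * x a →
        ∑ i : Fin (n + 1), y ^ (i : ℕ) * N i none = 0 ∧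
        ∑ i : Fin (n + 1), y ^ (i : ℕ) * ∑ c, N i (some c) * x c = 0 := by
      intro x hx y hy
      have h1 := hval x hx y hy
      have h2 := hval ((2 : ℂ) • x) (by simpa using hx) y (by simp [hy, mul_left_comm])
      simp only [Pi.smul_apply, smul_eq_mul, mul_left_comm _ (2 : ℂ), ← Finset.mul_sum, mul_add,
        Finset.sum_add_distrib] at h1 h2
      constructor
      · linear_combination 2 * h1 - h2
      · linear_combination h2 - h1
    have hnone : (fun i => N i none) = 0 := by
      refine eq_zero_of_forall_sum_pow_mul_eq_zero fun y => ?_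
      exact (hsplit (Pi.single a 1 + Pi.single b y) (by simp [hab]) y (by simp [hab.symm])).1
    have hlin : ∀ y, ∑ i : Fin (n + 1), y ^ (i : ℕ) * (N i (some a) + N i (some b) * y) = 0 := by
      intro y
      have := (hsplit (Pi.single a 1 + Pi.single b y) (by simp [hab]) y (by simp [hab.symm])).2
      simpa [mul_add, Finset.sum_add_distrib, Pi.single_apply] using this
    have hother : ∀ c, c ≠ a → c ≠ b → (fun i => N i (some c)) = 0 := by
      intro c hca hcb
      refine eq_zero_of_forall_sum_pow_mul_eq_zero fun y => ?_
      have h1 := (hsplit (Pi.single a 1 + Pi.single b y + Pi.single c 1)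
        (by simp [hab, hca.symm]) y (by simp [hab.symm, hcb.symm, hca.symm])).2
      have h2 := hlin y
      simp only [mul_add, Finset.sum_add_distrib, Pi.single_apply, Pi.add_apply, mul_ite, mul_one,
        mul_zero, Finset.sum_ite_eq', Finset.mem_univ, if_true] at h1 h2
      linear_combination h1 - h2
    -- Since `x b = y * x a`, the coefficients of `x b` are shifted by one power of `y`; the padding
    -- to length `n + 2` lists the coefficients of `1, y, …, y ^ (n + 1)`.
    have hab' : (fun i : Fin (n + 2) => (Fin.snoc (fun i => N i (some a)) 0 : Fin (n + 2) → ℂ) i +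
        (Fin.cons 0 (fun i => N i (some b)) : Fin (n + 2) → ℂ) i) = 0 := by
      refine eq_zero_of_forall_sum_pow_mul_eq_zero fun y => ?_
      simp only [mul_add, Finset.sum_add_distrib]
      rw [Fin.sum_univ_castSucc fun i : Fin (n + 2) =>
          y ^ (i : ℕ) * (Fin.snoc (fun i => N i (some a)) 0 : Fin (n + 2) → ℂ) i,
        Fin.sum_univ_succ fun i : Fin (n + 2) =>
          y ^ (i : ℕ) * (Fin.cons 0 (fun i => N i (some b)) : Fin (n + 2) → ℂ) i]
      simp only [Fin.snoc_castSucc, Fin.snoc_last, Fin.cons_zero, Fin.cons_succ, Fin.val_castSucc,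
        Fin.val_succ, mul_zero, add_zero, zero_add]
      refine Eq.trans ?_ (hlin y)
      rw [← Finset.sum_add_distrib]
      exact Finset.sum_congr rfl fun i _ => by ring
    have hb : ∀ i, N i (some b) = 0 := by
      intro i
      refine Fin.lastCases ?_ (fun i => ?_) i
      · have := congrFun hab' (Fin.last (n + 1))
        rw [← Fin.succ_last] at this
        simpa using this
      · exact congrFun hfN i
    have ha : ∀ i, N i (some a) = 0 := by
      intro i
      refine Fin.cases ?_ (fun i => ?_) i
      · simpa using congrFun hab' (Fin.castSucc 0)
      · have := congrFun hab' i.succ.castSucc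
        have h1 : (Fin.cons 0 (fun i => N i (some b)) : Fin (n + 2) → ℂ) i.succ.castSucc = 0 := by
          rw [← Fin.succ_castSucc, Fin.cons_succ, hb]
        simpa only [Fin.snoc_castSucc, h1, add_zero, Pi.zero_apply] using this
    ext i c
    rcases c with _ | c
    · exact congrFun hnone i
    · by_cases hca : c = a
      · rw [hca]
        exact ha i
      by_cases hcb : c = b
      · rw [hcb]
        exact hb i
      exact congrFun (hother c hca hcb) i
  have := LinearMap.finrank_le_finrank_of_injective hf
  rwa [Module.finrank_fintype_fun_eq_card, Fintype.card_fin] at this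

theorem _root_.AnalyticAt.matrix_det {E : Type*} [NormedAddCommGroup E] [NormedSpace ℂ E] {k : ℕ}
    {f : E → Matrix (Fin k) (Fin k) ℂ} {z : E} (hf : ∀ i j, AnalyticAt ℂ (fun y => f y i j) z) :
    AnalyticAt ℂ (fun y => (f y).det) z := by
  simp only [Matrix.det_apply']
  exact Finset.analyticAt_fun_sum _ fun σ _ =>
    analyticAt_const.mul (Finset.analyticAt_fun_prod _ fun i _ => hf _ _)

theorem analyticAt_syzygyMap (N : Fin (n + 1) → Option (Fin m) → ℂ) (x : Fin m → ℂ)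
    (T : LinCoeff m n) : AnalyticAt ℂ (fun T : LinCoeff m n => syzygyMap T N x) T := by
  simp only [syzygyMap, LinearMap.coe_mk, AddHom.coe_mk, signedMinor]
  refine Finset.analyticAt_fun_sum _ fun i _ => AnalyticAt.fun_mul ?_ analyticAt_const
  refine AnalyticAt.fun_mul analyticAt_const (AnalyticAt.matrix_det fun k j => ?_)
  simp only [Matrix.submatrix_apply, linValue, Matrix.of_apply]
  refine Finset.analyticAt_fun_sum _ fun a _ => AnalyticAt.fun_mul ?_ analyticAt_const
  exact (ContinuousLinearMap.proj (R := ℂ)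
    (φ := fun _ : Fin (n + 1) × Fin n × Fin m => ℂ) _).analyticAt T

/-- Every neighbourhood contains an open set of general matrices of linear forms. -/
theorem exists_nhds_isGeneral (hm : 2 ≤ m) {T : LinCoeff m n} {U : Set (LinCoeff m n)}
    (hU : U ∈ 𝓝 T) : ∃ T', ∃ V ∈ 𝓝 T', V ⊆ U ∧ ∀ S ∈ V, IsGeneral S := by
  have hab : (⟨0, by omega⟩ : Fin m) ≠ ⟨1, by omega⟩ := by simp
  have hgen := isGeneral_bidiagonal (n := n) hab
  set T₀ := bidiagonal n (⟨0, by omega⟩ : Fin m) ⟨1, by omega⟩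
  obtain ⟨q, x, hdet⟩ := exists_det_ne_zero (syzygyMap T₀) le_rfl
  have hdim : Module.finrank ℂ (Fin (n + 1) → Option (Fin m) → ℂ) ≤
      Module.finrank ℂ (LinearMap.range (syzygyMap T₀)) + n := by
    rw [← (syzygyMap T₀).finrank_range_add_finrank_ker]
    exact Nat.add_le_add_left hgen _
  -- A minor of full rank size for `T₀`. Where it is nonzero, the rank of `syzygyMap` is at least
  -- that of `T₀`, so its kernel has dimension at most `n`.
  let p : LinCoeff m n → ℂ := fun T => (Matrix.of fun i j => syzygyMap T (q j) (x i)).det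
  have hp : AnalyticOnNhd ℂ p Set.univ := fun T _ =>
    AnalyticAt.matrix_det fun i j => analyticAt_syzygyMap _ _ _
  -- If `p` vanished near `T`, it would vanish identically, also at `T₀`.
  have hex : ∃ᶠ S in 𝓝 T, p S ≠ 0 := by
    intro hev
    have h0 := hp.eqOn_zero_of_preconnected_of_eventuallyEq_zero isPreconnected_univ
      (Set.mem_univ T) (by filter_upwards [hev] with S hS using not_not.1 hS)
    exact hdet (h0 (Set.mem_univ T₀))
  obtain ⟨T', hT', hT'U⟩ := (hex.and_eventually (eventually_mem_nhds_iff.2 hU)).exists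
  have hcont : ContinuousAt p T' := (hp T' (Set.mem_univ _)).continuousAt
  refine ⟨T', U ∩ {S | p S ≠ 0}, Filter.inter_mem hT'U (hcont.eventually_ne hT'),
    Set.inter_subset_left, fun S hS => ?_⟩
  exact finrank_ker_le_of_det_ne_zero _ hdim hS.2

end GeneralLinearMatrices

/-! ### The case `n ≥ 3`: counting linear parts. -/

section LinearPerturbations

variable {m n : ℕ}

local notation "𝔪" => maxIdeal (0 : Fin m → ℂ)
local notation "𝒪" => LocalRingAt (0 : Fin m → ℂ)

theorem map_signedMinor {R S : Type*} [CommRing R] [CommRing S] (f : R →+* S)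
    (L : Matrix (Fin (n + 1)) (Fin n) R) (i : Fin (n + 1)) :
    f (signedMinor L i) = signedMinor (L.map f) i := by
  simp only [signedMinor, map_mul, map_pow, map_neg, map_one, RingHom.map_det]
  rfl

theorem span_range_signedMinor {R : Type*} [CommRing R] (L : Matrix (Fin (n + 1)) (Fin n) R) :
    Ideal.span (Set.range (signedMinor L)) = minorsIdeal L := by
  refine le_antisymm (Ideal.span_le.2 ?_) (Ideal.span_le.2 ?_)
  · rintro _ ⟨i, rfl⟩
    exact Ideal.mul_mem_left _ _ (Ideal.subset_span ⟨i, rfl⟩)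
  · rintro _ ⟨i, rfl⟩
    have h : (L.submatrix i.succAbove id).det = (-1) ^ (i : ℕ) * signedMinor L i := by
      rw [signedMinor, ← mul_assoc, ← mul_pow]
      simp
    change (L.submatrix i.succAbove id).det ∈ _
    rw [h]
    exact Ideal.mul_mem_left _ _ (Ideal.subset_span ⟨i, rfl⟩)

/-- The matrix of linear forms with coefficients `T`. -/
def linPoly (T : LinCoeff m n) : Matrix (Fin (n + 1)) (Fin n) (MvPolynomial (Fin m) ℂ) :=
  Matrix.of fun i j => ∑ a, MvPolynomial.C (T (i, j, a)) * MvPolynomial.X a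

theorem isHomogeneous_signedMinor_linPoly (T : LinCoeff m n) (i : Fin (n + 1)) :
    (signedMinor (linPoly T) i).IsHomogeneous n := by
  have hlin : ∀ k j, (linPoly T k j).IsHomogeneous 1 := fun k j => by
    simp only [linPoly, Matrix.of_apply]
    exact MvPolynomial.IsHomogeneous.sum _ _ _ fun a _ =>
      (MvPolynomial.isHomogeneous_X ℂ a).C_mul _
  have h1 : ((linPoly T).submatrix i.succAbove id).det.IsHomogeneous n := by
    rw [Matrix.det_apply']
    refine MvPolynomial.IsHomogeneous.sum _ _ _ fun σ _ => ?_
    have h2 := MvPolynomial.IsHomogeneous.prod Finset.univ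
      (fun k => (linPoly T).submatrix i.succAbove id (σ k) k) (fun _ => 1) fun k _ =>
        hlin (i.succAbove (σ k)) k
    have h3 := h2.C_mul ((Equiv.Perm.sign σ : ℤ) : ℂ)
    simpa using h3
  have h3 := h1.C_mul ((-1) ^ (i : ℕ))
  simpa [signedMinor] using h3

theorem eval_signedMinor_linPoly (T : LinCoeff m n) (x : Fin m → ℂ) (i : Fin (n + 1)) :
    MvPolynomial.eval x (signedMinor (linPoly T) i) = signedMinor (linValue T x) i := by
  rw [map_signedMinor]
  congr 1
  ext k j
  simp [linPoly, linValue]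

theorem signedMinor_mem {R : Type*} [CommRing R] {𝔞 : Ideal R}
    {L : Matrix (Fin (n + 1)) (Fin n) R} (hL : ∀ i j, L i j ∈ 𝔞) (i : Fin (n + 1)) :
    signedMinor L i ∈ 𝔞 ^ n :=
  Ideal.mul_mem_left _ _ (det_mem_pow fun _ _ => hL _ _)

theorem signedMinor_sub_mem {N : Matrix (Fin (n + 1)) (Fin n) 𝒪} (hN : ∀ i j, N i j ∈ 𝔪)
    {T : LinCoeff m n} (h : ∀ i j, N i j - ∑ a, T (i, j, a) • coord a ∈ 𝔪 ^ 2)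
    (i : Fin (n + 1)) :
    signedMinor N i - MvPolynomial.aeval coord (signedMinor (linPoly T) i) ∈ 𝔪 ^ (n + 1) := by
  have h1 : ∀ k j, MvPolynomial.aeval coord (linPoly T k j) = ∑ a, T (k, j, a) • coord a := by
    intro k j
    simp [linPoly, Algebra.smul_def]
  have h2 := map_signedMinor (MvPolynomial.aeval (R := ℂ) (coord (m := m))).toRingHom (linPoly T) i
  change MvPolynomial.aeval coord _ = _ at h2
  rw [h2, signedMinor, signedMinor, ← mul_sub]
  refine Ideal.mul_mem_left _ _ (det_sub_det_mem (fun _ _ => hN _ _) (fun k j => ?_) fun k j => ?_)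
  · change MvPolynomial.aeval coord _ ∈ _
    rw [h1]
    exact sum_coord_mem _
  · change _ - MvPolynomial.aeval coord _ ∈ _
    rw [h1]
    exact h _ _

/-- The left side of `hlt` counts the entries of `A`, `D` and `C` in `T(x) = D S(Ax) C`, the right
side the coefficients of a linear matrix. -/
theorem not_isSimpleSingularity_of_dimension_lt (hn : 2 ≤ n) (hm : 2 ≤ m)
    (hlt : m * m + (n + 1) * (n + 1) + n * n < (n + 1) * (n * m))
    {M : Matrix (Fin (n + 1)) (Fin n) 𝒪} (hM : ∀ i j, M i j ∈ 𝔪) : ¬IsSimpleSingularity M := by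
  intro hs
  let φ : Fin (n + 1) × Fin n × Fin m → Matrix (Fin (n + 1)) (Fin n) 𝒪 := fun b =>
    Matrix.of fun i j => if (i, j) = (b.1, b.2.1) then coord b.2.2 else 0
  have hφ : ∀ b i j, φ b i j ∈ 𝔪 := by
    intro b i j
    simp only [φ, Matrix.of_apply]
    split_ifs
    · exact coord_mem _
    · exact zero_mem _
  have hentry : ∀ t i j, perturb M φ t i j = M i j + ∑ a, t (i, j, a) • coord a := by
    intro t i j
    simp only [perturb, Matrix.of_apply, φ, Fintype.sum_prod_type, Prod.mk.injEq]
    rw [Finset.sum_eq_single i, Finset.sum_eq_single j]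
    · simp
    · intro k _ hk
      simp [hk.symm]
    · simp
    · intro k _ hk
      simp [hk.symm]
    · simp
  choose μ' hμ' using fun i j => exists_sub_sum_coord_mem (hM i j)
  let μ : LinCoeff m n := fun c => μ' c.1 c.2.1 c.2.2
  have hmem : ∀ t i j, perturb M φ t i j ∈ 𝔪 := fun t i j => by
    rw [hentry]
    exact add_mem (hM i j) (sum_coord_mem _)
  have hcong : ∀ t i j, perturb M φ t i j - ∑ a, (t + μ) (i, j, a) • coord a ∈ 𝔪 ^ 2 := by
    intro t i j
    rw [hentry]
    convert hμ' i j using 1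
    simp only [Pi.add_apply, add_smul, Finset.sum_add_distrib, μ]
    ring
  obtain ⟨U, hU, hfin⟩ := hs.exists_finite (by omega) hM φ hφ
  have hU' : (fun T => T - μ) ⁻¹' U ∈ 𝓝 μ := by
    have : ContinuousAt (fun T : LinCoeff m n => T - μ) μ := by fun_prop
    exact this.preimage_mem_nhds (by simpa using hU)
  -- The linear part of the perturbation with parameter `t` is `t + μ`. Both it and its
  -- representative must be general, so representatives are taken over `V`.
  obtain ⟨T', V, hV, hVU, hVgen⟩ := exists_nhds_isGeneral hm hU'
  obtain ⟨S, hSV, hSf, hS⟩ := hfin ((fun t => t + μ) ⁻¹' V) (fun t ht => by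
    simpa using hVU ht)
  let Ψ : LinCoeff m n →
      ((Fin m × Fin m) ⊕ (Fin (n + 1) × Fin (n + 1)) ⊕ (Fin n × Fin n) → ℂ) → LinCoeff m n :=
    fun s y c => ∑ l, (∑ k, y (Sum.inr (Sum.inl (c.1, k))) *
      ∑ b, (s + μ) (k, l, b) * y (Sum.inl (b, c.2.2))) * y (Sum.inr (Sum.inr (l, c.2.1)))
  have hΨ : ∀ s, AnalyticOnNhd ℂ (Ψ s) Set.univ := by
    intro s y _
    have hy : ∀ c, AnalyticAt ℂ (fun y : (Fin m × Fin m) ⊕ (Fin (n + 1) × Fin (n + 1)) ⊕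
        (Fin n × Fin n) → ℂ => y c) y :=
      fun c => (ContinuousLinearMap.proj (R := ℂ) (φ := fun _ : (Fin m × Fin m) ⊕
        (Fin (n + 1) × Fin (n + 1)) ⊕ (Fin n × Fin n) => ℂ) c).analyticAt y
    rw [analyticAt_pi_iff]
    intro c
    exact Finset.analyticAt_fun_sum _ fun l _ => (Finset.analyticAt_fun_sum _ fun k _ =>
      (hy _).mul (Finset.analyticAt_fun_sum _ fun b _ => analyticAt_const.mul (hy _))).mul (hy _)
  obtain ⟨T, hTV, hT⟩ := exists_mem_notMem_range hSf hΨ (by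
    rw [Module.finrank_fintype_fun_eq_card, Module.finrank_fintype_fun_eq_card]
    simp only [Fintype.card_sum, Fintype.card_prod, Fintype.card_fin]
    omega) hV
  obtain ⟨s, hsS, ⟨e⟩⟩ := hS (T - μ) (by simpa using hTV)
  rw [← span_range_signedMinor, ← span_range_signedMinor] at e
  obtain ⟨A, B, hA, hAB⟩ := exists_linear_of_algEquiv hn
    (isHomogeneous_signedMinor_linPoly (T - μ + μ)) (isHomogeneous_signedMinor_linPoly (s + μ))
    (signedMinor_mem (hmem _)) (signedMinor_mem (hmem _))
    (signedMinor_sub_mem (hmem _) (hcong _)) (signedMinor_sub_mem (hmem _) (hcong _)) e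
  simp only [eval_signedMinor_linPoly, sub_add_cancel] at hAB
  obtain ⟨D, C, hDC⟩ := (hVgen _ (hSV hsS)).exists_eq (hVgen _ hTV) hA hAB
  refine hT s hsS ⟨Sum.elim (fun ab => A ab.1 ab.2)
    (Sum.elim (fun ij => D ij.1 ij.2) fun ij => C ij.1 ij.2), ?_⟩
  -- Coefficients of a linear matrix are its values at the basis vectors.
  ext ⟨i, j, a⟩
  have h1 := congrFun (congrFun (hDC (Pi.single a 1)) i) j
  have h2 : linValue T (Pi.single a 1) i j = T (i, j, a) := by
    simp [linValue, Pi.single_apply]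
  rw [← h2, h1]
  simp [Ψ, Matrix.mul_apply, linValue]

end LinearPerturbations

/-! ### Leibniz rules for determinants and germs. -/

section Derivatives

theorem leibniz_prod {R ι : Type*} [CommRing R] [DecidableEq ι] {D : R → R}
    (hmul : ∀ f g, D (f * g) = f * D g + g * D f) (hone : D 1 = 0) (s : Finset ι) (f : ι → R) :
    D (∏ i ∈ s, f i) = ∑ i ∈ s, (∏ j ∈ s.erase i, f j) * D (f i) := by
  induction s using Finset.induction_on with
  | empty => simpa using hone
  | insert a s ha ih =>
    rw [Finset.prod_insert ha, hmul, ih, Finset.sum_insert ha, Finset.erase_insert ha,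
      Finset.mul_sum, add_comm]
    congr 1
    refine Finset.sum_congr rfl fun i hi => ?_
    have hne : a ≠ i := fun h => ha (h ▸ hi)
    rw [Finset.erase_insert_of_ne hne, Finset.prod_insert (by simp [ha]), mul_assoc]

/-- The derivative of a determinant is the sum of the determinants in which one column has been
differentiated. -/
theorem leibniz_det {R ι : Type*} [CommRing R] [DecidableEq ι] [Fintype ι] {D : R →+ R}
    (hmul : ∀ f g, D (f * g) = f * D g + g * D f) (hone : D 1 = 0) (N : Matrix ι ι R) :
    D N.det = ∑ i, (N.updateCol i fun k => D (N k i)).det := by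
  simp only [Matrix.det_apply, map_sum]
  rw [Finset.sum_comm]
  refine Finset.sum_congr rfl fun σ _ => ?_
  rw [Units.smul_def, map_zsmul, leibniz_prod hmul hone, Finset.smul_sum]
  refine Finset.sum_congr rfl fun i _ => ?_
  rw [← Finset.prod_erase_mul _ _ (Finset.mem_univ i), Matrix.updateCol_self]
  congr 2
  refine Finset.prod_congr rfl fun j hj => ?_
  rw [Matrix.updateCol_ne (Finset.ne_of_mem_erase hj)]

variable {m : ℕ} {p : Fin m → ℂ}

theorem analyticAt_fderiv_apply (a : Fin m) {f : (Fin m → ℂ) → ℂ} (hf : AnalyticAt ℂ f p) :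
    AnalyticAt ℂ (fun x => fderiv ℂ f x (Pi.single a 1)) p :=
  (ContinuousLinearMap.apply ℂ ℂ (Pi.single a 1 : Fin m → ℂ)).analyticAt _ |>.comp hf.fderiv

theorem pderiv_add (a : Fin m) (f g : LocalRingAt p) :
    pderiv a (f + g) = pderiv a f + pderiv a g := by
  obtain ⟨f, hf, rfl⟩ := exists_germ_eq f
  obtain ⟨g, hg, rfl⟩ := exists_germ_eq g
  rw [← germ_add hf hg, pderiv_germ a hf, pderiv_germ a hg,
    ← germ_add (analyticAt_fderiv_apply a hf) (analyticAt_fderiv_apply a hg)]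
  refine (pderiv_germ a (hf.add hg)).trans
    (germ_congr (analyticAt_fderiv_apply a (hf.add hg)) ?_)
  filter_upwards [hf.eventually_analyticAt, hg.eventually_analyticAt] with x h1 h2
  rw [fderiv_add h1.differentiableAt h2.differentiableAt]
  rfl

theorem pderiv_mul (a : Fin m) (f g : LocalRingAt p) :
    pderiv a (f * g) = f * pderiv a g + g * pderiv a f := by
  obtain ⟨f, hf, rfl⟩ := exists_germ_eq f
  obtain ⟨g, hg, rfl⟩ := exists_germ_eq g
  have hf' := analyticAt_fderiv_apply a hf
  have hg' := analyticAt_fderiv_apply a hg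
  rw [← germ_mul hf hg, pderiv_germ a hf, pderiv_germ a hg, ← germ_mul hf hg', ← germ_mul hg hf']
  refine Eq.trans ?_ (germ_add (hf.mul hg') (hg.mul hf'))
  refine (pderiv_germ a (hf.mul hg)).trans
    (germ_congr (analyticAt_fderiv_apply a (hf.mul hg)) ?_)
  filter_upwards [hf.eventually_analyticAt, hg.eventually_analyticAt] with x h1 h2
  rw [fderiv_mul h1.differentiableAt h2.differentiableAt]
  rfl

theorem pderiv_one (a : Fin m) : pderiv a (1 : LocalRingAt p) = 0 := by
  have h := pderiv_mul a (1 : LocalRingAt p) 1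
  simp only [mul_one, one_mul] at h
  simpa using h

/-- The partial derivative as an additive map. -/
def pderivHom (p : Fin m → ℂ) (a : Fin m) : LocalRingAt p →+ LocalRingAt p :=
  AddMonoidHom.mk' (pderiv a) (pderiv_add a)

end Derivatives

/-! ### The singular locus contains the locus where the rank drops by two. -/

section LowMinors

variable {q : ℕ}

/-- The ideal generated by the minors of size `q + 1` of a `(q+3) × (q+2)` matrix. -/
def lowMinors {R : Type*} [CommRing R] (L : Matrix (Fin (q + 3)) (Fin (q + 2)) R) : Ideal R :=
  Ideal.span (Set.range fun rc : (Fin (q + 1) → Fin (q + 3)) × (Fin (q + 1) → Fin (q + 2)) =>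
    (L.submatrix rc.1 rc.2).det)

theorem det_submatrix_mem_lowMinors {R : Type*} [CommRing R]
    (L : Matrix (Fin (q + 3)) (Fin (q + 2)) R) (r : Fin (q + 1) → Fin (q + 3))
    (c : Fin (q + 1) → Fin (q + 2)) : (L.submatrix r c).det ∈ lowMinors L :=
  Ideal.subset_span ⟨(r, c), rfl⟩

/-- Expansion along the replaced column has minors of `L` itself as cofactors, whatever `v` is.
Every summand in the derivative of a maximal minor has this shape. -/
theorem det_updateCol_mem_lowMinors {R : Type*} [CommRing R]
    (L : Matrix (Fin (q + 3)) (Fin (q + 2)) R) (i : Fin (q + 3)) (j : Fin (q + 2))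
    (v : Fin (q + 2) → R) : ((L.submatrix i.succAbove id).updateCol j v).det ∈ lowMinors L := by
  rw [Matrix.det_succ_column _ j]
  refine Ideal.sum_mem _ fun k _ => Ideal.mul_mem_left _ _ ?_
  have h : ((L.submatrix i.succAbove id).updateCol j v).submatrix k.succAbove j.succAbove =
      L.submatrix (i.succAbove ∘ k.succAbove) j.succAbove := by
    ext a b
    simp
  rw [h]
  exact det_submatrix_mem_lowMinors _ _ _

theorem minorsIdeal_le_lowMinors {R : Type*} [CommRing R]
    (L : Matrix (Fin (q + 3)) (Fin (q + 2)) R) : minorsIdeal L ≤ lowMinors L := by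
  rw [minorsIdeal, Ideal.span_le]
  rintro _ ⟨i, rfl⟩
  have := det_updateCol_mem_lowMinors L i 0 fun k => (L.submatrix i.succAbove id) k 0
  rwa [Matrix.updateCol_eq_self] at this

theorem pderiv_mem_lowMinors {m : ℕ} {p : Fin m → ℂ}
    {M : Matrix (Fin (q + 3)) (Fin (q + 2)) (LocalRingAt p)} {f : LocalRingAt p}
    (hf : f ∈ minorsIdeal M) (a : Fin m) : pderiv a f ∈ lowMinors M := by
  obtain ⟨c, rfl⟩ := Ideal.mem_span_range_iff_exists_fun.1 hf
  change pderivHom p a _ ∈ _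
  rw [map_sum]
  refine Ideal.sum_mem _ fun i _ => ?_
  change pderiv a _ ∈ _
  rw [pderiv_mul]
  refine add_mem (Ideal.mul_mem_left _ _ ?_) (Ideal.mul_mem_right _ _ ?_)
  · have := leibniz_det (D := pderivHom p a) (pderiv_mul a) (pderiv_one a)
      (M.submatrix i.succAbove id)
    change pderiv a _ = _ at this
    rw [this]
    exact Ideal.sum_mem _ fun j _ => det_updateCol_mem_lowMinors _ _ _ _
  · exact minorsIdeal_le_lowMinors M (Ideal.subset_span ⟨i, rfl⟩)

theorem singularLocusIdeal_le_lowMinors {m : ℕ} {p : Fin m → ℂ}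
    (M : Matrix (Fin (q + 3)) (Fin (q + 2)) (LocalRingAt p)) :
    singularLocusIdeal (minorsIdeal M) ≤ lowMinors M := by
  refine sup_le (minorsIdeal_le_lowMinors M) (Ideal.span_le.2 ?_)
  rintro _ ⟨f, hf, g, -, a, b, rfl⟩
  exact sub_mem (Ideal.mul_mem_right _ _ (pderiv_mem_lowMinors hf a))
    (Ideal.mul_mem_right _ _ (pderiv_mem_lowMinors hf b))

end LowMinors

/-! ### An upper bound for Hilbert functions. -/

section Counting

variable {B ι κ : Type*} [CommRing B] [Algebra ℂ B] [Fintype ι] [Fintype κ]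

/-- The coefficients of the `h i` in the remainder are themselves reduced modulo `h` and `𝔞`; each
round gains one power of the ideal of `h`. -/
theorem exists_sub_sum_aeval_mem {h : ι → B} {b : κ → B} {𝔞 : Ideal B}
    (H : ∀ f, ∃ c : κ → ℂ, f - ∑ k, c k • b k ∈ Ideal.span (Set.range h) ⊔ 𝔞) (N : ℕ) :
    ∀ f, ∃ d : κ → MvPolynomial ι ℂ,
      f - ∑ k, MvPolynomial.aeval h (d k) * b k ∈ Ideal.span (Set.range h) ^ N ⊔ 𝔞 := by
  induction N with
  | zero => simp
  | succ N ih =>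
    intro f
    obtain ⟨c, hc⟩ := H f
    obtain ⟨u, hu, v, hv, huv⟩ := Submodule.mem_sup.1 hc
    obtain ⟨g, rfl⟩ := Ideal.mem_span_range_iff_exists_fun.1 hu
    choose d hd using fun i => ih (g i)
    refine ⟨fun k => MvPolynomial.C (c k) + ∑ i, MvPolynomial.X i * d i k, ?_⟩
    have h1 : f - ∑ k, MvPolynomial.aeval h (MvPolynomial.C (c k) +
        ∑ i, MvPolynomial.X i * d i k) * b k =
        v + ∑ i, h i * (g i - ∑ k, MvPolynomial.aeval h (d i k) * b k) := by
      rw [sub_eq_iff_eq_add.1 huv.symm]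
      simp only [map_add, MvPolynomial.aeval_C, map_sum, map_mul, MvPolynomial.aeval_X, add_mul,
        Finset.sum_add_distrib, Algebra.smul_def, mul_sub, Finset.sum_sub_distrib, Finset.sum_mul,
        Finset.mul_sum]
      rw [Finset.sum_comm (s := (Finset.univ : Finset κ))]
      simp only [mul_assoc, mul_comm (h _) (g _)]
      ring
    rw [h1]
    refine add_mem (Ideal.mem_sup_right hv) (Ideal.sum_mem _ fun i _ => ?_)
    obtain ⟨u', hu', v', hv', huv'⟩ := Submodule.mem_sup.1 (hd i)
    rw [← huv', mul_add]
    refine add_mem (Ideal.mem_sup_left ?_) (Ideal.mem_sup_right (Ideal.mul_mem_left _ _ hv'))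
    rw [pow_succ']
    exact Ideal.mul_mem_mul (Ideal.subset_span ⟨i, rfl⟩) hu'

/-- If finitely many elements span `B` modulo the ideal generated by `h` and `𝔞`, then their
products with monomials in `h` span `B` modulo powers of that ideal. -/
theorem mem_span_box {h : ι → B} {b : κ → B} {𝔞 : Ideal B}
    (H : ∀ f, ∃ c : κ → ℂ, f - ∑ k, c k • b k ∈ Ideal.span (Set.range h) ⊔ 𝔞) (N : ℕ) (f : B) :
    Ideal.Quotient.mk (Ideal.span (Set.range h) ^ N ⊔ 𝔞) f ∈ Submodule.span ℂ (Set.range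
      fun p : κ × (ι → Fin N) => Ideal.Quotient.mk (Ideal.span (Set.range h) ^ N ⊔ 𝔞)
        ((∏ i, h i ^ (p.2 i : ℕ)) * b p.1)) := by
  set Q := Ideal.span (Set.range h) ^ N ⊔ 𝔞 with hQ
  obtain ⟨d, hd⟩ := exists_sub_sum_aeval_mem H N f
  rw [Ideal.Quotient.eq.2 hd, map_sum]
  refine Submodule.sum_mem _ fun k _ => ?_
  have h1 : MvPolynomial.aeval h (d k) * b k = ∑ s ∈ (d k).support,
      (d k).coeff s • ((∏ i, h i ^ s i) * b k) := by
    simp only [MvPolynomial.aeval_def, MvPolynomial.eval₂_eq', Finset.sum_mul, Algebra.smul_def,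
      mul_assoc]
  rw [h1, map_sum]
  refine Submodule.sum_mem _ fun s _ => ?_
  change (d k).coeff s • Ideal.Quotient.mk Q ((∏ i, h i ^ s i) * b k) ∈ _
  refine Submodule.smul_mem _ _ ?_
  by_cases hs : ∀ i, s i < N
  · exact Submodule.subset_span ⟨(k, fun i => ⟨s i, hs i⟩), rfl⟩
  · push Not at hs
    obtain ⟨i, hi⟩ := hs
    have : (∏ i, h i ^ s i) * b k ∈ Q := by
      refine Ideal.mem_sup_left (Ideal.mul_mem_right _ _ ?_)
      refine Ideal.mem_of_dvd _ (Finset.dvd_prod_of_mem _ (Finset.mem_univ i)) ?_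
      have hmem : h i ∈ Ideal.span (Set.range h) := Ideal.subset_span ⟨i, rfl⟩
      exact Ideal.pow_le_pow_right hi (Ideal.pow_mem_pow hmem _)
    rw [Ideal.Quotient.eq_zero_iff_mem.2 this]
    exact zero_mem _

/-- An elementary form of the bound on dimension by the number of equations: if `|ι|` equations cut
`B ⧸ 𝔞` down to finite dimension, then its quotients by their `N`-th powers grow at most like `N ^
|ι|`. -/
theorem card_le_of_linearIndependent {h : ι → B} {b : κ → B} {𝔞 : Ideal B}
    (H : ∀ f, ∃ c : κ → ℂ, f - ∑ k, c k • b k ∈ Ideal.span (Set.range h) ⊔ 𝔞) (N : ℕ)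
    {τ : Type*} [Fintype τ] {v : τ → B}
    (hv : ∀ c : τ → ℂ, ∑ i, c i • v i ∈ Ideal.span (Set.range h) ^ N ⊔ 𝔞 → c = 0) :
    Fintype.card τ ≤ Fintype.card κ * N ^ Fintype.card ι := by
  classical
  set Q := Ideal.span (Set.range h) ^ N ⊔ 𝔞 with hQ
  let w : κ × (ι → Fin N) → B ⧸ Q := fun p =>
    Ideal.Quotient.mk Q ((∏ i, h i ^ (p.2 i : ℕ)) * b p.1)
  have hspan : Submodule.span ℂ (Set.range w) = ⊤ := by
    rw [eq_top_iff]
    rintro f -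
    obtain ⟨f, rfl⟩ := Ideal.Quotient.mk_surjective f
    exact mem_span_box H N f
  have hfin : Module.Finite ℂ (B ⧸ Q) :=
    ⟨⟨Finset.univ.image w, by rw [Finset.coe_image, Finset.coe_univ, Set.image_univ, hspan]⟩⟩
  have hli : LinearIndependent ℂ fun i => Ideal.Quotient.mk Q (v i) := by
    rw [Fintype.linearIndependent_iff]
    intro c hc
    have h1 : ∑ i, c i • v i ∈ Q := by
      rw [← Ideal.Quotient.eq_zero_iff_mem, map_sum]
      exact hc
    exact congrFun (hv c h1)
  have h1 := hli.fintype_card_le_finrank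
  have h2 := finrank_range_le_card (R := ℂ) w
  rw [Set.finrank, hspan, finrank_top] at h2
  refine (h1.trans h2).trans (le_of_eq ?_)
  simp

end Counting

/-! ### The locus of rank at most `q` has codimension at most six. -/

section RankLocus

variable {m q : ℕ}

local notation "𝔪" => maxIdeal (0 : Fin m → ℂ)
local notation "𝒪" => LocalRingAt (0 : Fin m → ℂ)

theorem det_mul_eq_zero {K : Type*} [Field K] (U : Matrix (Fin (q + 1)) (Fin q) K)
    (V : Matrix (Fin q) (Fin (q + 1)) K) : (U * V).det = 0 := by
  by_contra h
  have h1 := Matrix.rank_of_isUnit (U * V) ((Matrix.isUnit_iff_isUnit_det _).2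
    (isUnit_iff_ne_zero.2 h))
  have h2 := (Matrix.rank_mul_le_left U V).trans (Matrix.rank_le_card_width U)
  rw [h1, Fintype.card_fin, Fintype.card_fin] at h2
  omega

/-- The positions in a `(q+3) × (q+2)` matrix outside the lower right `3 × 2` block. -/
abbrev OuterIndex (q : ℕ) : Type :=
  {ij : Fin (q + 3) × Fin (q + 2) // (ij.1 : ℕ) < q ∨ (ij.2 : ℕ) < q}

theorem card_le_card_outerIndex :
    (q + 3) * (q + 2) ≤ Fintype.card (OuterIndex q) + 6 := by
  have h1 : Fintype.card
      {ij : Fin (q + 3) × Fin (q + 2) // ¬((ij.1 : ℕ) < q ∨ (ij.2 : ℕ) < q)} =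
      Fintype.card (Fin (q + 3) × Fin (q + 2)) - Fintype.card (OuterIndex q) :=
    Fintype.card_subtype_compl _
  have h2 : Fintype.card {ij : Fin (q + 3) × Fin (q + 2) // ¬((ij.1 : ℕ) < q ∨ (ij.2 : ℕ) < q)} ≤
      Fintype.card (Fin 3 × Fin 2) := by
    refine Fintype.card_le_of_injective
      (fun x => (⟨x.1.1 - q, by omega⟩, ⟨x.1.2 - q, by omega⟩)) ?_
    rintro ⟨⟨i, j⟩, h⟩ ⟨⟨i', j'⟩, h'⟩ heq
    simp only [Prod.mk.injEq, Fin.mk.injEq] at heq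
    simp only [Subtype.mk.injEq, Prod.mk.injEq, Fin.ext_iff]
    dsimp only at h h'
    omega
  simp only [Fintype.card_prod, Fintype.card_fin] at h1 h2
  omega

/-- The upper left `q × q` block of a partially filled matrix. -/
def cornerBlock {R : Type*} (w : OuterIndex q → R) : Matrix (Fin q) (Fin q) R :=
  Matrix.of fun i j => w ⟨(Fin.castAdd 3 i, Fin.castAdd 2 j), Or.inl i.2⟩

/-- A partially filled matrix with invertible corner can be completed to a matrix of rank at most
`q`. -/
theorem exists_completion {w : OuterIndex q → ℂ} (hw : (cornerBlock w).det ≠ 0) :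
    ∃ y : Matrix (Fin (q + 3)) (Fin (q + 2)) ℂ, (∀ ij : OuterIndex q, y ij.1.1 ij.1.2 = w ij) ∧
      ∀ (r : Fin (q + 1) → Fin (q + 3)) (c : Fin (q + 1) → Fin (q + 2)),
        (y.submatrix r c).det = 0 := by
  let U : Matrix (Fin (q + 3)) (Fin q) ℂ :=
    Matrix.of fun i l => w ⟨(i, Fin.castAdd 2 l), Or.inr l.2⟩
  let T : Matrix (Fin q) (Fin (q + 2)) ℂ :=
    Matrix.of fun l j => w ⟨(Fin.castAdd 3 l, j), Or.inl l.2⟩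
  have hunit : IsUnit (cornerBlock w).det := isUnit_iff_ne_zero.2 hw
  -- `U` holds the first `q` columns and `T` the first `q` rows. The product reproduces both and
  -- factors through ℂ^q, so its rank is at most `q`.
  refine ⟨U * ((cornerBlock w)⁻¹ * T), ?_, fun r c => ?_⟩
  · rintro ⟨⟨i, j⟩, hij⟩
    rcases hij with h | h
    · have h1 : ∀ l, U i l = cornerBlock w ⟨i, h⟩ l := fun l => rfl
      calc (U * ((cornerBlock w)⁻¹ * T)) i j
          = (cornerBlock w * ((cornerBlock w)⁻¹ * T)) ⟨i, h⟩ j := by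
            simp only [Matrix.mul_apply, h1]
        _ = T ⟨i, h⟩ j := by rw [Matrix.mul_nonsing_inv_cancel_left _ _ hunit]
        _ = _ := rfl
    · have h1 : ∀ l, T l j = cornerBlock w l ⟨j, h⟩ := fun l => rfl
      rw [← Matrix.mul_assoc]
      calc (U * (cornerBlock w)⁻¹ * T) i j
          = (U * (cornerBlock w)⁻¹ * cornerBlock w) i ⟨j, h⟩ := by
            rw [Matrix.mul_apply, Matrix.mul_apply]
            simp only [h1]
        _ = U i ⟨j, h⟩ := by rw [Matrix.nonsing_inv_mul_cancel_right _ _ hunit]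
        _ = _ := rfl
  · have h1 : (U * ((cornerBlock w)⁻¹ * T)).submatrix r c =
        U.submatrix r id * ((cornerBlock w)⁻¹ * T).submatrix id c := by
      ext
      simp [Matrix.mul_apply]
    rw [h1, det_mul_eq_zero]

/-- The polynomials over the ring of germs in the entries of a `(q+3) × (q+2)` matrix. -/
abbrev EntryPoly (m q : ℕ) : Type :=
  MvPolynomial (Fin (q + 3) × Fin (q + 2)) (LocalRingAt (0 : Fin m → ℂ))

/-- The generic matrix. -/
def genericMatrix (m q : ℕ) : Matrix (Fin (q + 3)) (Fin (q + 2)) (EntryPoly m q) :=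
  Matrix.of fun i j => MvPolynomial.X (i, j)

/-- The coordinates on `ℂ^m` and on the space of matrices. -/
def jointCoord (m q : ℕ) : Fin m ⊕ (Fin (q + 3) × Fin (q + 2)) → EntryPoly m q :=
  Sum.elim (fun a => MvPolynomial.C (coord a)) MvPolynomial.X

/-- The ideal of the origin in the product of `ℂ^m` and the space of matrices. -/
def originIdeal (m q : ℕ) : Ideal (EntryPoly m q) :=
  Ideal.span (Set.range (jointCoord m q))

theorem C_mem_originIdeal {g : 𝒪} (hg : g ∈ 𝔪) :
    (MvPolynomial.C g : EntryPoly m q) ∈ originIdeal m q := by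
  have h1 := Ideal.mem_map_of_mem (MvPolynomial.C (σ := Fin (q + 3) × Fin (q + 2))) hg
  rw [maxIdeal_eq_span, Ideal.map_span] at h1
  refine Ideal.span_mono ?_ h1
  rintro _ ⟨_, ⟨a, rfl⟩, rfl⟩
  exact ⟨Sum.inl a, rfl⟩

theorem X_mem_originIdeal (ij : Fin (q + 3) × Fin (q + 2)) :
    (MvPolynomial.X ij : EntryPoly m q) ∈ originIdeal m q :=
  Ideal.subset_span ⟨Sum.inr ij, rfl⟩

theorem exists_sub_algebraMap_mem_originIdeal (f : EntryPoly m q) :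
    ∃ c : ℂ, f - algebraMap ℂ _ c ∈ originIdeal m q := by
  induction f using MvPolynomial.induction_on with
  | C g =>
    refine ⟨evalGerm 0 g, ?_⟩
    rw [IsScalarTower.algebraMap_apply ℂ 𝒪 (EntryPoly m q), MvPolynomial.algebraMap_eq, ← map_sub]
    exact C_mem_originIdeal (sub_algebraMap_evalGerm_mem g)
  | add f g hf hg =>
    obtain ⟨c, hc⟩ := hf
    obtain ⟨d, hd⟩ := hg
    refine ⟨c + d, ?_⟩
    rw [map_add, add_sub_add_comm]
    exact add_mem hc hd
  | mul_X f ij _ =>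
    refine ⟨0, ?_⟩
    rw [map_zero, sub_zero]
    exact Ideal.mul_mem_left _ _ (X_mem_originIdeal ij)

theorem sup_pow_le_sup_pow {R : Type*} [CommRing R] (I J : Ideal R) (k : ℕ) :
    (I ⊔ J) ^ k ≤ I ⊔ J ^ k := by
  induction k with
  | zero => simp
  | succ k ih =>
    rw [pow_succ, pow_succ]
    refine (Ideal.mul_mono_left ih).trans ?_
    rw [Ideal.sup_mul, Ideal.mul_sup (J ^ k)]
    have h1 : I * (I ⊔ J) ≤ I := Ideal.mul_le_left
    have h2 : J ^ k * I ≤ I := Ideal.mul_le_right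
    exact sup_le (h1.trans le_sup_left) (sup_le (h2.trans le_sup_left) le_sup_right)

/-- The equations of the graph of a matrix of germs. -/
def graphEq (M : Matrix (Fin (q + 3)) (Fin (q + 2)) 𝒪) (ij : Fin (q + 3) × Fin (q + 2)) :
    EntryPoly m q :=
  MvPolynomial.X ij - MvPolynomial.C (M ij.1 ij.2)

theorem map_lowMinors_le (M : Matrix (Fin (q + 3)) (Fin (q + 2)) 𝒪) :
    (lowMinors M).map (MvPolynomial.C : 𝒪 →+* EntryPoly m q) ≤
      Ideal.span (Set.range (graphEq M)) ⊔ lowMinors (genericMatrix m q) := by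
  rw [lowMinors, Ideal.map_span, Ideal.span_le]
  rintro _ ⟨_, ⟨⟨r, c⟩, rfl⟩, rfl⟩
  set J := Ideal.span (Set.range (graphEq M)) with hJ
  have h1 : MvPolynomial.C (M.submatrix r c).det - ((genericMatrix m q).submatrix r c).det ∈ J := by
    rw [← Ideal.Quotient.eq, RingHom.map_det, RingHom.map_det, RingHom.map_det]
    congr 1
    ext i j
    refine (Ideal.Quotient.eq.2 ?_).symm
    exact Ideal.subset_span ⟨(r i, c j), rfl⟩
  have h2 := add_mem (Ideal.mem_sup_left (T := lowMinors (genericMatrix m q)) h1)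
    (Ideal.mem_sup_right (det_submatrix_mem_lowMinors (genericMatrix m q) r c))
  rwa [sub_add_cancel] at h2

/-- Modulo the graph equations each variable becomes an entry of `M`, so the origin ideal reduces to
𝔪 and the minors of `M` to generic minors. Thus the cone of low rank matrices meets the graph only
at the origin. -/
theorem originIdeal_pow_le {M : Matrix (Fin (q + 3)) (Fin (q + 2)) 𝒪} (hM : ∀ i j, M i j ∈ 𝔪)
    {k : ℕ} (hk : 𝔪 ^ k ≤ lowMinors M) : originIdeal m q ^ k ≤
      Ideal.span (Set.range (graphEq M)) ⊔ lowMinors (genericMatrix m q) := by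
  set J := Ideal.span (Set.range (graphEq M)) with hJ
  have h1 : originIdeal m q ≤ J ⊔ Ideal.map MvPolynomial.C 𝔪 := by
    rw [originIdeal, Ideal.span_le]
    rintro _ ⟨a | ij, rfl⟩
    · exact Ideal.mem_sup_right (Ideal.mem_map_of_mem _ (coord_mem a))
    · have h2 := add_mem (Ideal.mem_sup_left (T := Ideal.map MvPolynomial.C 𝔪)
        (Ideal.subset_span ⟨ij, rfl⟩ : graphEq M ij ∈ J))
        (Ideal.mem_sup_right (Ideal.mem_map_of_mem MvPolynomial.C (hM ij.1 ij.2)))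
      rwa [graphEq, sub_add_cancel] at h2
  refine (Ideal.pow_right_mono h1 k).trans ((sup_pow_le_sup_pow _ _ k).trans ?_)
  refine sup_le le_sup_left ?_
  rw [← Ideal.map_pow]
  exact (Ideal.map_mono hk).trans (map_lowMinors_le M)

theorem span_graphEq_le {M : Matrix (Fin (q + 3)) (Fin (q + 2)) 𝒪} (hM : ∀ i j, M i j ∈ 𝔪) :
    Ideal.span (Set.range (graphEq M)) ≤ originIdeal m q := by
  rw [Ideal.span_le]
  rintro _ ⟨ij, rfl⟩
  exact sub_mem (X_mem_originIdeal ij) (C_mem_originIdeal (hM _ _))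

/-- The polynomials in the coordinates of `ℂ^m` and in the outer entries of the matrix. -/
def outerHom (m q : ℕ) : MvPolynomial (Fin m ⊕ OuterIndex q) ℂ →ₐ[ℂ] EntryPoly m q :=
  MvPolynomial.aeval (Sum.elim (fun a => MvPolynomial.C (coord a)) fun ij => MvPolynomial.X ij.1)

/-- On the line through `w` the polynomial has degree less than `N` in `z` and is divisible by `z ^
N`, so it is zero; its value at `z = 1` is `f(w)`. -/
theorem eval_eq_zero_of_aeval_line_mem {σ : Type*} {f : MvPolynomial σ ℂ} {N : ℕ}
    (hN : f.totalDegree < N) (w : σ → ℂ)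
    (h : MvPolynomial.aeval (fun s => coord (0 : Fin 1) * algebraMap ℂ _ (w s)) f ∈
      Ideal.span {coord (0 : Fin 1)} ^ N) : MvPolynomial.eval w f = 0 := by
  obtain ⟨P, hP⟩ : ∃ P : Polynomial ℂ,
      P = MvPolynomial.aeval (fun s => Polynomial.X * Polynomial.C (w s)) f := ⟨_, rfl⟩
  have hdeg : P.natDegree < N := by
    refine lt_of_le_of_lt ?_ hN
    have := MvPolynomial.aeval_natDegree_le f (n := 1) le_rfl
      (fun s => (Polynomial.X * Polynomial.C (w s) : Polynomial ℂ)) fun s =>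
        Polynomial.natDegree_mul_C_le _ _ |>.trans Polynomial.natDegree_X_le
    rwa [mul_one, ← hP] at this
  have h1 : Polynomial.aeval (coord (0 : Fin 1)) P =
      MvPolynomial.aeval (fun s => coord (0 : Fin 1) * algebraMap ℂ _ (w s)) f := by
    rw [hP, ← AlgHom.comp_apply, MvPolynomial.comp_aeval]
    simp only [map_mul, Polynomial.aeval_X, Polynomial.aeval_C]
  have h2 : Polynomial.aeval (1 : ℂ) P = MvPolynomial.eval w f := by
    rw [hP, ← AlgHom.comp_apply, MvPolynomial.comp_aeval, ← MvPolynomial.aeval_eq_eval]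
    simp
  rw [← h1] at h
  rw [← h2, polynomial_eq_zero_of_aeval_coord_mem hdeg h, map_zero]

/-- The outer entries `w` are completed to a matrix `y` of rank at most `q`. The line through the
origin and this point stays in the cone, so restriction to it kills the low minors and sends the
origin ideal into `(z)`. -/
theorem eval_eq_zero_of_outerHom_mem {f : MvPolynomial (Fin m ⊕ OuterIndex q) ℂ} {N : ℕ}
    (hN : f.totalDegree < N)
    (hf : outerHom m q f ∈ originIdeal m q ^ N ⊔ lowMinors (genericMatrix m q))
    {w : Fin m ⊕ OuterIndex q → ℂ} (hw : (cornerBlock fun ij => w (Sum.inr ij)).det ≠ 0) :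
    MvPolynomial.eval w f = 0 := by
  obtain ⟨y, hyw, hy⟩ := exists_completion hw
  let z : LocalRingAt (0 : Fin 1 → ℂ) := coord 0
  let ev : EntryPoly m q →+* LocalRingAt (0 : Fin 1 → ℂ) :=
    MvPolynomial.eval₂Hom (lineHom fun a => w (Sum.inl a)).toRingHom
      fun ij => z * algebraMap ℂ _ (y ij.1 ij.2)
  have hevC : ∀ a, ev (MvPolynomial.C (coord a)) = z * algebraMap ℂ _ (w (Sum.inl a)) := by
    intro a
    change MvPolynomial.eval₂Hom _ _ _ = _
    rw [MvPolynomial.eval₂Hom_C]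
    refine (lineHom_coord _ a).trans ?_
    rw [Algebra.smul_def, mul_comm]
  have hevX : ∀ ij, ev (MvPolynomial.X ij) = z * algebraMap ℂ _ (y ij.1 ij.2) := fun ij =>
    MvPolynomial.eval₂Hom_X' _ _ _
  have hle : (originIdeal m q ^ N ⊔ lowMinors (genericMatrix m q)).map ev ≤ Ideal.span {z} ^ N := by
    rw [Ideal.map_sup, Ideal.map_pow]
    refine sup_le (Ideal.pow_right_mono ?_ N) ?_
    · rw [originIdeal, Ideal.map_span, Ideal.span_le]
      rintro _ ⟨_, ⟨a | ij, rfl⟩, rfl⟩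
      · change ev (MvPolynomial.C (coord a)) ∈ _
        rw [hevC]
        exact Ideal.mul_mem_right _ _ (Ideal.mem_span_singleton_self z)
      · change ev (MvPolynomial.X ij) ∈ _
        rw [hevX]
        exact Ideal.mul_mem_right _ _ (Ideal.mem_span_singleton_self z)
    · rw [lowMinors, Ideal.map_span, Ideal.span_le]
      rintro _ ⟨_, ⟨⟨r, c⟩, rfl⟩, rfl⟩
      have h1 : ev.mapMatrix ((genericMatrix m q).submatrix r c) =
          z • (algebraMap ℂ (LocalRingAt (0 : Fin 1 → ℂ))).mapMatrix (y.submatrix r c) := by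
        ext i j
        exact hevX (r i, c j)
      change ev ((genericMatrix m q).submatrix r c).det ∈ _
      rw [RingHom.map_det, h1, Matrix.det_smul, ← RingHom.map_det, hy, map_zero, mul_zero]
      exact zero_mem _
  have hmem := hle (Ideal.mem_map_of_mem ev hf)
  refine eval_eq_zero_of_aeval_line_mem hN w ?_
  let ev' : EntryPoly m q →ₐ[ℂ] LocalRingAt (0 : Fin 1 → ℂ) := AlgHom.mk ev fun c => by
    rw [IsScalarTower.algebraMap_apply ℂ 𝒪 (EntryPoly m q), MvPolynomial.algebraMap_eq]
    exact (MvPolynomial.eval₂Hom_C _ _ _).trans ((lineHom _).commutes c)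
  have h1 : ev' (outerHom m q f) =
      MvPolynomial.aeval (fun s => coord (0 : Fin 1) * algebraMap ℂ _ (w s)) f := by
    rw [outerHom, ← AlgHom.comp_apply, MvPolynomial.comp_aeval]
    congr 2
    ext s
    rcases s with a | ij
    · exact hevC a
    · rw [← hyw]
      exact hevX ij.1
  rw [← h1]
  exact hmem

/-- The product of `f` with the corner determinant vanishes at every point, and that determinant is
not the zero polynomial. -/
theorem eq_zero_of_outerHom_mem {f : MvPolynomial (Fin m ⊕ OuterIndex q) ℂ} {N : ℕ}
    (hN : f.totalDegree < N)
    (hf : outerHom m q f ∈ originIdeal m q ^ N ⊔ lowMinors (genericMatrix m q)) : f = 0 := by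
  let d : MvPolynomial (Fin m ⊕ OuterIndex q) ℂ :=
    (cornerBlock fun ij => MvPolynomial.X (Sum.inr ij)).det
  have hd : ∀ w, MvPolynomial.eval w d = (cornerBlock fun ij => w (Sum.inr ij)).det := by
    intro w
    change MvPolynomial.eval w (Matrix.det _) = _
    rw [RingHom.map_det]
    congr 1
    ext i j
    simp [cornerBlock]
  have hd0 : d ≠ 0 := by
    intro h0
    have h1 := hd (Sum.elim 0 fun ij => if (ij.1.1 : ℕ) = ij.1.2 then 1 else 0)
    have h2 : (cornerBlock fun ij : OuterIndex q => (Sum.elim 0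
        (fun ij : OuterIndex q => if (ij.1.1 : ℕ) = ij.1.2 then (1 : ℂ) else 0) :
          Fin m ⊕ OuterIndex q → ℂ) (Sum.inr ij)) = 1 := by
      ext i j
      simp [cornerBlock, Matrix.one_apply, Fin.ext_iff]
    rw [h2, h0, map_zero, Matrix.det_one] at h1
    exact zero_ne_one h1
  have h1 : f * d = 0 := by
    refine MvPolynomial.funext fun w => ?_
    rw [map_mul, map_zero, hd]
    by_cases hw : (cornerBlock fun ij => w (Sum.inr ij)).det = 0
    · rw [hw, mul_zero]
    · rw [eval_eq_zero_of_outerHom_mem hN hf hw, zero_mul]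
  exact (mul_eq_zero.1 h1).resolve_right hd0

/-- The locus where a matrix of size `(q+3) × (q+2)` vanishing at the origin has rank at most `q` is
not concentrated at the origin if there are more than six variables. -/
theorem not_maxIdeal_pow_le_lowMinors (hm : 7 ≤ m) {M : Matrix (Fin (q + 3)) (Fin (q + 2)) 𝒪}
    (hM : ∀ i j, M i j ∈ 𝔪) (k : ℕ) : ¬𝔪 ^ k ≤ lowMinors M := by
  classical
  intro hk
  -- Monomials with exponents below `k`; the trailing factor 1 is the one-element spanning family in
  -- `mem_span_box`.
  let b : Unit × (Fin m ⊕ (Fin (q + 3) × Fin (q + 2)) → Fin k) → EntryPoly m q :=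
    fun p => (∏ i, jointCoord m q i ^ (p.2 i : ℕ)) * 1
  have H : ∀ f, ∃ c : Unit × (Fin m ⊕ (Fin (q + 3) × Fin (q + 2)) → Fin k) → ℂ,
      f - ∑ p, c p • b p ∈
        Ideal.span (Set.range (graphEq M)) ⊔ lowMinors (genericMatrix m q) := by
    intro f
    have h1 := mem_span_box (h := jointCoord m q) (b := fun _ : Unit => 1) (𝔞 := ⊥) (fun f => by
      obtain ⟨c, hc⟩ := exists_sub_algebraMap_mem_originIdeal f
      refine ⟨fun _ => c, Ideal.mem_sup_left ?_⟩
      simpa [Algebra.smul_def, originIdeal] using hc) k f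
    obtain ⟨c, hc⟩ := (Submodule.mem_span_range_iff_exists_fun ℂ).1 h1
    refine ⟨c, originIdeal_pow_le hM hk ?_⟩
    have h2 : Ideal.Quotient.mk (Ideal.span (Set.range (jointCoord m q)) ^ k ⊔ ⊥) f =
        Ideal.Quotient.mk _ (∑ p, c p • b p) := by
      rw [← hc, map_sum]
      rfl
    have h3 := Ideal.Quotient.eq.1 h2
    rwa [sup_bot_eq] at h3
  set K := Fintype.card (Unit × (Fin m ⊕ (Fin (q + 3) × Fin (q + 2)) → Fin k)) with hK
  set s := Fintype.card (Fin m ⊕ OuterIndex q) with hs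
  -- At most six matrix positions are not outer, and `m ≥ 7` more than makes up for them.
  have hsE : (q + 3) * (q + 2) + 1 ≤ s := by
    have := card_le_card_outerIndex (q := q)
    rw [hs, Fintype.card_sum, Fintype.card_fin]
    omega
  -- Counting with `N = s * L` will give `L ^ s ≤ K * (s * L) ^ E`, where `E = (q + 3) * (q + 2) <
  -- s`, hence `L ≤ K * s ^ E`. This `L` is one too large for that. Monomials with all exponents
  -- below `L` have degree less than `s * L`.
  set L := K * s ^ ((q + 3) * (q + 2)) + 1 with hL
  have hcount := card_le_of_linearIndependent H (s * L)
    (v := fun β : Fin m ⊕ OuterIndex q → Fin L =>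
      outerHom m q (MvPolynomial.monomial (Finsupp.equivFunOnFinite.symm fun i => (β i : ℕ)) 1))
    (fun c hc => by
      set f : MvPolynomial (Fin m ⊕ OuterIndex q) ℂ := ∑ β : Fin m ⊕ OuterIndex q → Fin L,
        c β • MvPolynomial.monomial (Finsupp.equivFunOnFinite.symm fun i => (β i : ℕ)) 1 with hf
      have h1 : ∑ β, c β • outerHom m q (MvPolynomial.monomial
          (Finsupp.equivFunOnFinite.symm fun i => (β i : ℕ)) 1) = outerHom m q f := by
        simp only [hf, map_sum, map_smul]
      rw [h1] at hc
      have hdeg : f.totalDegree < s * L := by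
        refine lt_of_le_of_lt (MvPolynomial.totalDegree_finsetSum_le (d := s * (L - 1))
          fun β _ => ?_) (Nat.mul_lt_mul_of_pos_left (by omega) (by omega))
        refine (MvPolynomial.totalDegree_smul_le _ _).trans ?_
        refine (MvPolynomial.totalDegree_monomial_le _ _).trans ?_
        rw [Finsupp.sum_fintype _ _ fun _ => rfl, hs, ← smul_eq_mul, ← Finset.card_univ]
        refine Finset.sum_le_card_nsmul _ _ _ fun i _ => ?_
        have := (β i).2
        change (β i : ℕ) ≤ L - 1
        omega
      have h2 : f = 0 := eq_zero_of_outerHom_mem hdeg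
        (sup_le_sup_right (Ideal.pow_right_mono (span_graphEq_le hM) _) _ hc)
      ext β
      have h3 := congrArg
        (MvPolynomial.coeff (Finsupp.equivFunOnFinite.symm fun i => (β i : ℕ))) h2
      rw [hf, MvPolynomial.coeff_sum, Finset.sum_eq_single β] at h3
      · simpa using h3
      · intro γ _ hγ
        rw [MvPolynomial.coeff_smul, MvPolynomial.coeff_monomial, if_neg, smul_zero]
        intro heq
        refine hγ (funext fun i => Fin.ext ?_)
        exact congrFun (Finsupp.equivFunOnFinite.symm.injective heq) i
      · simp)
  rw [Fintype.card_fun, Fintype.card_fin, ← hs, ← hK, Fintype.card_prod, Fintype.card_fin,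
    Fintype.card_fin, mul_pow] at hcount
  have h1 : L ^ ((q + 3) * (q + 2) + 1) ≤ L ^ s := Nat.pow_le_pow_right (by omega) hsE
  have h2 : L * L ^ ((q + 3) * (q + 2)) ≤
      (K * s ^ ((q + 3) * (q + 2))) * L ^ ((q + 3) * (q + 2)) := by
    rw [← pow_succ', mul_assoc]
    exact h1.trans hcount
  have h3 := Nat.le_of_mul_le_mul_right h2 (pow_pos (by omega) _)
  omega

end RankLocus

/-! ### Conclusion: the cases of `n`. -/

theorem DefinesIsolatedCodimTwo.lt_seven {m q : ℕ}
    {M : Matrix (Fin (q + 2 + 1)) (Fin (q + 2)) (LocalRingAt (0 : Fin m → ℂ))}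
    (hM : ∀ i j, M i j ∈ maxIdeal (0 : Fin m → ℂ)) (h : DefinesIsolatedCodimTwo M) : m < 7 := by
  by_contra hm
  obtain ⟨k, hk⟩ := h.isolated
  exact not_maxIdeal_pow_le_lowMinors (not_lt.1 hm) hM k
    (hk.trans (singularLocusIdeal_le_lowMinors M))

theorem DefinesIsolatedCodimTwo.minor_mem {m n : ℕ}
    {M : Matrix (Fin (n + 1)) (Fin n) (LocalRingAt (0 : Fin m → ℂ))}
    (h : DefinesIsolatedCodimTwo M) (i : Fin (n + 1)) :
    (M.submatrix i.succAbove id).det ∈ maxIdeal (0 : Fin m → ℂ) ^ 2 :=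
  h.embedding_dim (Ideal.subset_span ⟨i, rfl⟩)

end

end CMTwo

theorem mainTheorem4 (m n : ℕ) (hm : 3 ≤ m)
    (M : Matrix (Fin (n + 1)) (Fin n) (CMTwo.LocalRingAt (0 : Fin m → ℂ)))
    (hM : ∀ i j, M i j ∈ CMTwo.maxIdeal (0 : Fin m → ℂ))
    (hiso : CMTwo.DefinesIsolatedCodimTwo M)
    (hsimple : CMTwo.IsSimpleSingularity M) :
    n < 3 ∧ m < 7 := by
  match n, M, hM, hiso, hsimple with
  -- The only minor is the empty determinant 1, which is not in 𝔪².
  | 0, M, hM, hiso, hsimple =>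
    have h := Ideal.pow_le_self two_ne_zero (hiso.minor_mem 0)
    rw [Matrix.det_isEmpty, CMTwo.mem_maxIdeal, map_one] at h
    exact absurd h one_ne_zero
  | 1, M, hM, hiso, hsimple =>
    refine ⟨by omega, ?_⟩
    by_contra hm7
    refine CMTwo.not_isSimpleSingularity_of_pencil (by omega) (fun i => ?_) hsimple
    fin_cases i
    · simpa using hiso.minor_mem 1
    · simpa using hiso.minor_mem 0
  | q + 2, M, hM, hiso, hsimple =>
    have hm7 := hiso.lt_seven hM
    refine ⟨?_, hm7⟩
    by_contra hn
    refine CMTwo.not_isSimpleSingularity_of_dimension_lt (by omega) (by omega) ?_ hM hsimple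
    obtain ⟨r, rfl⟩ : ∃ r, q = r + 1 := ⟨q - 1, by omega⟩
    -- With `n = r + 3` and `m` from 3 to 6; the tightest case `m = n = 3` reads `34 < 36`.
    interval_cases m <;> nlinarith
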